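/- Let $\Bbbk$ be a field and let $\mathcal M$ be a collection of finite matroids that contains the uniform matroids and is closed under isomorphism, direct sums and minors. Let $\Bbbk\widetilde{\mathcal M}$ be the vector space with basis the isomorphism classes of matroids in $\mathcal M$, with multiplication $M\cdot N=M\oplus N$, unit $U^0_0$, comultiplication $\Delta(M)=\sum_{A\subseteq E(M)}M|_A\otimes M/A$, and counit $\epsilon(M)=1$ if $E(M)=\emptyset$ and $\epsilon(M)=0$ otherwise. Then there is exactly one linear map $S$ on $\Bbbk\widetilde{\mathcal M}$ that is an antipode, i.e. $\mu\circ(S\otimes\mathrm{id})\circ\Delta=\mu\circ(\mathrm{id}\otimes S)\circ\Delta=\eta\circ\epsilon$, and it satisfies the following formula. Let $0\le m\le n$, let $E$ be a set with $n$ elements, and let $<$ be a total order on $E$. For a finite set $J$ let $U^r_J$ be the uniform matroid with ground set $J$ in which the independent sets are the subsets with at most $r$ elements; $U^m_n=U^m_E$. Then $$S(U^m_n)=\sum_{\pi}\mathrm{sgn}(\pi)\;U^{|I|}_I\oplus U^{m-|I|}_L\oplus U^0_{E\setminus(I\cup L)},$$ where $\pi=(B_1,\dots,B_j)$ ranges over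 all ordered set partitions of $E$ (sequences of nonempty disjoint sets with union $E$) that are fixed by the split-merge map $\iota_<$. Here $\mathrm{sgn}(\pi)=(-1)^j$, $\ell\ge 1$ is the first index with $|B_1|+\dots+|B_\ell|\ge m$, $I=B_1\cup\dots\cup B_{\ell-1}$ and $L=B_\ell$ (for $n=0$, $I=L=\emptyset$). The map $\iota_<$ goes through the parts from left to right and changes $\pi$ at the first part $B_i$ to which one of the following rules applies (if there is none, $\pi$ is fixed). Split: if $|B_i|>1$, and $i\ne\ell$ or $|B_1|+\dots+|B_\ell|=m$, then $B_i$ is replaced by the two parts $\{\max B_i\},\ B_i\setminus\{\max B_i\}$. Merge: if $B_i=\{e\}$, $i<j$, $i\neq\ell$, $e$ is larger than every element of $B_{i+1}$, and it is not the case that both $i+1=\ell$ and $|B_1|+\dots+|B_\ell|>m$, then $B_i,B_{i+1}$ are replaced by the single part $B_i\cup B_{i+1}$. -/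

import Mathlib

universe u

open scoped TensorProduct

namespace MatroidHopf

/-! ## Finite matroids and their isomorphism classes -/

/-- A matroid on a finite ground set (`M.E` is finite; the ambient type need not be). -/
structure FinMatroid : Type (u + 1) where
  carrier : Type u
  toMatroid : Matroid carrier
  finite : toMatroid.Finite

/-- The ground set, as a `Finset`. -/
noncomputable def FinMatroid.ground (M : FinMatroid.{u}) : Finset M.carrier :=
  M.finite.ground_finite.toFinset

/-- The restriction `M|_A`. -/
def FinMatroid.restrict (M : FinMatroid.{u}) (A : Finset M.carrier) : FinMatroid.{u} where
  carrier := M.carrier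
  toMatroid := M.toMatroid.restrict A
  finite := ⟨A.finite_toSet⟩

/-- The contraction `M/A`, a matroid on `M.E \ A`. -/
def FinMatroid.contract (M : FinMatroid.{u}) (A : Finset M.carrier) : FinMatroid.{u} where
  carrier := M.carrier
  toMatroid := M.toMatroid.contract A
  finite := ⟨M.finite.ground_finite.subset Set.sdiff_subset⟩

/-- The direct sum, on the disjoint union of the ground sets. -/
def FinMatroid.directSum (M N : FinMatroid.{u}) : FinMatroid.{u} where
  carrier := M.carrier ⊕ N.carrier
  toMatroid := M.toMatroid.sum N.toMatroid
  finite := ⟨by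
    rw [Matroid.sum_ground]
    exact (M.finite.ground_finite.image _).union (N.finite.ground_finite.image _)⟩

/-- The empty matroid `U^0_0`. -/
def FinMatroid.empty : FinMatroid.{u} where
  carrier := PEmpty
  toMatroid := Matroid.emptyOn PEmpty
  finite := ⟨Set.toFinite _⟩

/-- Isomorphism of matroids: a bijection of the ground sets under which the independent sets
correspond to each other. -/
def FinMatroid.Iso (M N : FinMatroid.{u}) : Prop :=
  ∃ e : M.toMatroid.E ≃ N.toMatroid.E, ∀ I : Set M.toMatroid.E,
    M.toMatroid.Indep (Subtype.val '' I) ↔ N.toMatroid.Indep (Subtype.val '' (e '' I))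

theorem FinMatroid.Iso.refl (M : FinMatroid.{u}) : M.Iso M := ⟨Equiv.refl _, fun I => by simp⟩

theorem FinMatroid.Iso.symm {M N : FinMatroid.{u}} (h : M.Iso N) : N.Iso M := by
  obtain ⟨e, he⟩ := h
  refine ⟨e.symm, fun I => ?_⟩
  rw [he (e.symm '' I), Equiv.image_symm_image]

theorem FinMatroid.Iso.trans {M N P : FinMatroid.{u}} (h : M.Iso N) (h' : N.Iso P) : M.Iso P := by
  obtain ⟨e, he⟩ := h
  obtain ⟨f, hf⟩ := h'
  refine ⟨e.trans f, fun I => (he I).trans ?_⟩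
  rw [hf (e '' I), Set.image_image f e]
  rfl

instance FinMatroid.setoid : Setoid FinMatroid.{u} where
  r := FinMatroid.Iso
  iseqv := ⟨FinMatroid.Iso.refl, FinMatroid.Iso.symm, FinMatroid.Iso.trans⟩

/-- Isomorphism classes of finite matroids. -/
def MatroidClass : Type (u + 1) := Quotient FinMatroid.setoid.{u}

/-- The isomorphism class of a matroid. -/
def FinMatroid.toClass (M : FinMatroid.{u}) : MatroidClass.{u} := Quotient.mk _ M

/-- The image of a matroid under an injective map. -/
def FinMatroid.map (M : FinMatroid.{u}) {β : Type u} (f : M.carrier ↪ β) : FinMatroid.{u} where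
  carrier := β
  toMatroid := M.toMatroid.map f f.injective.injOn
  finite := ⟨M.finite.ground_finite.image f⟩

theorem FinMatroid.toClass_map (M : FinMatroid.{u}) {β : Type u} (f : M.carrier ↪ β) :
    (M.map f).toClass = M.toClass := by
  refine Eq.symm (Quotient.sound ⟨Equiv.Set.image f M.toMatroid.E f.injective, fun I => ?_⟩)
  have hI : Subtype.val '' I ⊆ M.toMatroid.E := by
    rintro _ ⟨x, -, rfl⟩; exact x.2
  have h : Subtype.val '' (Equiv.Set.image f M.toMatroid.E f.injective '' I) =
      f '' (Subtype.val '' I) := by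
    rw [Set.image_image, Set.image_image]; rfl
  refine (Matroid.map_image_indep_iff (hf := f.injective.injOn) hI).symm.trans ?_
  rw [← h]; rfl

/-- A function of finite matroids that is invariant under injective relabelling of the elements is
an isomorphism invariant. -/
theorem FinMatroid.Iso.apply_eq {X : Sort*} (F : FinMatroid.{u} → X)
    (hF : ∀ (P : FinMatroid.{u}) (β : Type u) (f : P.carrier ↪ β), F (P.map f) = F P)
    {M N : FinMatroid.{u}} (h : M.Iso N) : F M = F N := by
  obtain ⟨α, M, hM⟩ := M
  obtain ⟨β, N, hN⟩ := N
  obtain ⟨e, he⟩ := h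
  dsimp only at e he
  let P : FinMatroid.{u} := ⟨M.E, M.restrictSubtype M.E, inferInstance⟩
  let f : P.carrier ↪ α := ⟨Subtype.val, Subtype.val_injective⟩
  let g : P.carrier ↪ β := ⟨fun x => (e x : β), Subtype.val_injective.comp e.injective⟩
  have h1 : (⟨α, M, hM⟩ : FinMatroid.{u}) = P.map f := by
    simp [FinMatroid.map, P, f]
  have h2 : (⟨β, N, hN⟩ : FinMatroid.{u}) = P.map g := by
    simp only [FinMatroid.map, FinMatroid.mk.injEq, heq_eq_eq, true_and]
    refine Matroid.ext_indep ?_ fun I hI => ?_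
    · ext y
      constructor
      · intro hy
        exact ⟨e.symm ⟨y, hy⟩, by simp [P], by simp [g]⟩
      · rintro ⟨x, -, rfl⟩
        exact (e x).2
    · obtain ⟨J, rfl⟩ : ∃ J : Set M.E, I = Subtype.val '' (e '' J) := by
        refine ⟨e ⁻¹' (Subtype.val ⁻¹' I), ?_⟩
        rw [Equiv.image_preimage, Subtype.image_preimage_coe, Set.inter_eq_self_of_subset_right hI]
      rw [← he J, ← Matroid.restrictSubtype_indep_iff]
      refine (Matroid.map_image_indep_iff (f := fun x => ((e x : N.E) : β))
        (hf := (Subtype.val_injective.comp e.injective).injOn) (by simp)).symm.trans ?_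
      rw [Set.image_image]
      rfl
  rw [h1, h2, hF, hF]

section MatroidLemmas

variable {α β γ δ : Type*}

theorem map_restrict_image (M : Matroid α) {f : α → β} (hf : f.Injective) {A : Set α}
    (hA : A ⊆ M.E) :
    (M.map f hf.injOn).restrict (f '' A) = (M.restrict A).map f hf.injOn := by
  refine Matroid.ext_indep (by simp) fun I hI => ?_
  obtain ⟨J, hJ, rfl⟩ := Set.subset_image_iff.1 hI
  rw [Matroid.restrict_indep_iff, Matroid.map_image_indep_iff (hJ.trans hA),
    Matroid.map_image_indep_iff (by simpa using hJ), Matroid.restrict_indep_iff,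
    Set.image_subset_image_iff hf]

theorem map_contract_image (M : Matroid α) {f : α → β} (hf : f.Injective) {A : Set α}
    (hA : A ⊆ M.E) :
    (M.map f hf.injOn).contract (f '' A) = (M.contract A).map f hf.injOn := by
  obtain ⟨K, hK⟩ := M.exists_isBasis A
  have hK' := hK.map (f := f) hf.injOn
  refine Matroid.ext_indep (by simp [Set.image_sdiff hf]) fun I hI => ?_
  simp only [Matroid.contract_ground, Matroid.map_ground] at hI
  rw [← Set.image_sdiff hf] at hI
  obtain ⟨J, hJ, rfl⟩ := Set.subset_image_iff.1 hI
  rw [hK'.contract_indep_iff, Matroid.map_image_indep_iff (by simpa using hJ),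
    hK.contract_indep_iff, ← Set.image_union, Matroid.map_image_indep_iff,
    Set.disjoint_image_iff hf]
  exact Set.union_subset (hJ.trans Set.sdiff_subset) (hK.subset.trans hA)

theorem map_sum_map (M : Matroid α) (N : Matroid γ) {f : α → β} (hf : f.Injective) {g : γ → δ}
    (hg : g.Injective) :
    (M.map f hf.injOn).sum (N.map g hg.injOn) =
      (M.sum N).map (Sum.map f g) (hf.sumMap hg).injOn := by
  have hE : ((M.map f hf.injOn).sum (N.map g hg.injOn)).E = Sum.map f g '' (M.sum N).E := by
    simp [Set.image_union, Set.image_image]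
  refine Matroid.ext_indep hE fun I hI => ?_
  rw [hE] at hI
  obtain ⟨J, hJ, rfl⟩ := Set.subset_image_iff.1 hI
  have h1 : Sum.inl ⁻¹' (Sum.map f g '' J) = f '' (Sum.inl ⁻¹' J) := by
    ext x; simp
  have h2 : Sum.inr ⁻¹' (Sum.map f g '' J) = g '' (Sum.inr ⁻¹' J) := by
    ext x; simp
  rw [Matroid.map_image_indep_iff hJ, Matroid.sum_indep_iff, Matroid.sum_indep_iff, h1, h2,
    Matroid.map_image_indep_iff, Matroid.map_image_indep_iff]
  · intro x hx
    simpa using hJ hx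
  · intro x hx
    simpa using hJ hx

theorem sum_assoc_map (M : Matroid α) (N : Matroid β) (P : Matroid γ) :
    ((M.sum N).sum P).mapEquiv (Equiv.sumAssoc α β γ) = M.sum (N.sum P) := by
  refine Matroid.ext_indep ?_ fun I _ => ?_
  · ext (x | x | x) <;> simp
  · simp only [Matroid.mapEquiv_indep_iff, Matroid.sum_indep_iff, and_assoc, Equiv.image_symm_eq_preimage]
    rfl

theorem sum_comm_map (M : Matroid α) (N : Matroid β) :
    (M.sum N).mapEquiv (Equiv.sumComm α β) = N.sum M := by
  refine Matroid.ext_indep ?_ fun I _ => ?_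
  · ext (x | x) <;> simp
  · simp only [Matroid.mapEquiv_indep_iff, Matroid.sum_indep_iff, Equiv.image_symm_eq_preimage]
    exact and_comm

theorem empty_sum_map (M : Matroid α) :
    ((Matroid.emptyOn PEmpty).sum M).mapEquiv (Equiv.emptySum PEmpty α) = M := by
  refine Matroid.ext_indep ?_ fun I _ => ?_
  · ext x; simp
  · simp only [Matroid.mapEquiv_indep_iff, Matroid.sum_indep_iff, Equiv.image_symm_eq_preimage]
    refine (and_iff_right ?_).trans Iff.rfl
    simp [Set.eq_empty_of_isEmpty]

end MatroidLemmas

theorem FinMatroid.toClass_eq_of_map {α β : Type u} {M : Matroid α} {N : Matroid β}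
    (hM : M.Finite) (hN : N.Finite) (f : α → β) (hf : f.Injective) (h : M.map f hf.injOn = N) :
    (⟨α, M, hM⟩ : FinMatroid.{u}).toClass = (⟨β, N, hN⟩ : FinMatroid.{u}).toClass := by
  subst h
  exact (FinMatroid.toClass_map ⟨α, M, hM⟩ ⟨f, hf⟩).symm

theorem FinMatroid.directSum_comm (M N : FinMatroid.{u}) :
    (M.directSum N).toClass = (N.directSum M).toClass :=
  toClass_eq_of_map _ _ (Equiv.sumComm M.carrier N.carrier) (Equiv.injective _)
    (sum_comm_map M.toMatroid N.toMatroid)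

theorem FinMatroid.Iso.directSum_right {M N : FinMatroid.{u}} (h : M.Iso N) (P : FinMatroid.{u}) :
    (M.directSum P).toClass = (N.directSum P).toClass := by
  refine h.apply_eq (fun M => (M.directSum P).toClass) fun Q β f => ?_
  refine (toClass_eq_of_map _ _ (Sum.map f id) (f.injective.sumMap Function.injective_id) ?_).symm
  refine (map_sum_map _ _ f.injective Function.injective_id).symm.trans ?_
  rw [Matroid.map_id]
  rfl

theorem FinMatroid.Iso.directSum {M M' N N' : FinMatroid.{u}} (h : M.Iso M') (h' : N.Iso N') :
    (M.directSum N).toClass = (M'.directSum N').toClass := by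
  rw [h.directSum_right N, directSum_comm, h'.directSum_right M', directSum_comm]

/-- Isomorphism classes of finite matroids form a commutative monoid under direct sum, with unit
the class of the empty matroid. -/
instance : CommMonoid MatroidClass.{u} where
  mul := Quotient.lift₂ (fun M N => (M.directSum N).toClass) fun _ _ _ _ h h' => h.directSum h'
  one := FinMatroid.empty.toClass
  mul_assoc := by
    rintro ⟨M⟩ ⟨N⟩ ⟨P⟩
    exact FinMatroid.toClass_eq_of_map _ _ (Equiv.sumAssoc M.carrier N.carrier P.carrier)
      (Equiv.injective _) (sum_assoc_map M.toMatroid N.toMatroid P.toMatroid)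
  one_mul := by
    rintro ⟨M⟩
    exact FinMatroid.toClass_eq_of_map _ _ (Equiv.emptySum PEmpty M.carrier)
      (Equiv.injective _) (empty_sum_map M.toMatroid)
  mul_one := by
    rintro ⟨M⟩
    exact (FinMatroid.directSum_comm M FinMatroid.empty).trans
      (FinMatroid.toClass_eq_of_map _ _ (Equiv.emptySum PEmpty M.carrier)
        (Equiv.injective _) (empty_sum_map M.toMatroid))
  mul_comm := by
    rintro ⟨M⟩ ⟨N⟩
    exact FinMatroid.directSum_comm M N

theorem toFinset_image_eq_map {α β : Type*} {E : Set α} (hE : E.Finite) (f : α ↪ β)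
    (h : (f '' E).Finite) : h.toFinset = hE.toFinset.map f := by
  ext x
  simp

/-- The number of elements of the ground set. -/
noncomputable def MatroidClass.size : MatroidClass.{u} → ℕ :=
  Quotient.lift (fun M => M.ground.card) fun _ _ h =>
    h.apply_eq (fun M => M.ground.card) fun P _ f =>
      (congrArg Finset.card (toFinset_image_eq_map P.finite.ground_finite f _)).trans
        (Finset.card_map f)

/-- The pairs `(M|_A, M/A)` of isomorphism classes, for all subsets `A` of the ground set of `M`,
counted with multiplicity. -/
noncomputable def FinMatroid.cutPairs (M : FinMatroid.{u}) :
    Multiset (MatroidClass.{u} × MatroidClass.{u}) :=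
  M.ground.powerset.val.map fun A => ((M.restrict A).toClass, (M.contract A).toClass)

theorem FinMatroid.cutPairs_map (P : FinMatroid.{u}) (β : Type u) (f : P.carrier ↪ β) :
    (P.map f).cutPairs = P.cutPairs := by
  obtain ⟨α, M, hM⟩ := P
  dsimp only at f
  change FinMatroid.cutPairs ⟨β, M.map f f.injective.injOn, _⟩ = _
  unfold FinMatroid.cutPairs FinMatroid.ground
  dsimp only
  have h0 : (Matroid.map M f f.injective.injOn).ground_finite.toFinset =
      hM.ground_finite.toFinset.map f := toFinset_image_eq_map hM.ground_finite f _
  have hp : (Matroid.map M f f.injective.injOn).ground_finite.toFinset.powerset =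
      hM.ground_finite.toFinset.powerset.map ⟨Finset.map f, Finset.map_injective f⟩ := by
    rw [h0]
    ext A
    simp only [Finset.mem_powerset, Finset.mem_map, Function.Embedding.coeFn_mk,
      Finset.subset_map_iff, eq_comm]
  rw [hp, Finset.map_val, Multiset.map_map]
  refine Multiset.map_congr rfl fun A hA => ?_
  have hA' : (A : Set α) ⊆ M.E := fun x hx => by
    simpa using Finset.mem_powerset.1 hA hx
  refine Prod.ext ?_ ?_
  · refine (toClass_eq_of_map _ _ f f.injective ?_).symm
    rw [← map_restrict_image _ f.injective hA']
    simp
  · refine (toClass_eq_of_map _ _ f f.injective ?_).symm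
    rw [← map_contract_image _ f.injective hA']
    simp

/-- The pairs `(M|_A, M/A)` of an isomorphism class. -/
noncomputable def MatroidClass.cutPairs :
    MatroidClass.{u} → Multiset (MatroidClass.{u} × MatroidClass.{u}) :=
  Quotient.lift FinMatroid.cutPairs fun _ _ h => h.apply_eq _ FinMatroid.cutPairs_map

/-! ## Uniform matroids -/

/-- The uniform matroid `U^r_I` on the finite set `I`: a subset of `I` is independent if and only
if it has at most `r` elements. -/
def uniform {E : Type u} (r : ℕ) (I : Finset E) : FinMatroid.{u} where
  carrier := E
  toMatroid := (IndepMatroid.ofFinite (E := (I : Set E)) I.finite_toSet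
    (fun X => X ⊆ I ∧ X.ncard ≤ r)
    ⟨Set.empty_subset _, by simp⟩
    (fun X Y hY hXY => ⟨hXY.trans hY.1,
      (Set.ncard_le_ncard hXY (I.finite_toSet.subset hY.1)).trans hY.2⟩)
    (fun X Y hX hY h => by
      obtain ⟨e, heY, heX⟩ := Set.exists_mem_notMem_of_ncard_lt_ncard h
        (I.finite_toSet.subset hX.1)
      refine ⟨e, heY, heX, Set.insert_subset (hY.1 heY) hX.1, ?_⟩
      rw [Set.ncard_insert_of_notMem heX (I.finite_toSet.subset hX.1)]
      exact (Nat.succ_le_of_lt h).trans hY.2)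
    (fun X hX => hX.1)).matroid
  finite := ⟨I.finite_toSet⟩

/-! ## The restriction-contraction matroid Hopf algebra -/

/-- A collection of (isomorphism classes of) finite matroids that contains the uniform matroids and
is closed under direct sums and under minors. -/
structure MatroidFamily : Type (u + 1) where
  /-- The isomorphism classes in the collection, a monoid under direct sum. -/
  classes : Submonoid MatroidClass.{u}
  restrict_mem : ∀ (M : FinMatroid.{u}) (A : Finset M.carrier), A ⊆ M.ground →
    M.toClass ∈ classes → (M.restrict A).toClass ∈ classes
  contract_mem : ∀ (M : FinMatroid.{u}) (A : Finset M.carrier), A ⊆ M.ground →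
    M.toClass ∈ classes → (M.contract A).toClass ∈ classes
  uniform_mem : ∀ (E : Type u) (r : ℕ) (I : Finset E), (uniform r I).toClass ∈ classes

theorem MatroidFamily.cutPairs_mem (F : MatroidFamily.{u}) (c : MatroidClass.{u})
    (hc : c ∈ F.classes) : ∀ p ∈ c.cutPairs, p.1 ∈ F.classes ∧ p.2 ∈ F.classes := by
  obtain ⟨M⟩ := c
  intro p hp
  obtain ⟨A, hA, rfl⟩ := Multiset.mem_map.1 hp
  have hA' : A ⊆ M.ground := Finset.mem_powerset.1 hA
  exact ⟨F.restrict_mem M A hA' hc, F.contract_mem M A hA' hc⟩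

section HopfAlgebra

variable (k : Type*) [Field k] (F : MatroidFamily.{u})

/-- The vector space with basis the isomorphism classes in the collection, with the direct sum
as multiplication: the monoid algebra. Its coalgebra structure is given by `comul` and `counit`
below (the group-like coalgebra structure of Mathlib on monoid algebras plays no role). -/
abbrev MatroidAlgebra : Type _ := MonoidAlgebra k F.classes

/-- The basis element given by an isomorphism class. -/
noncomputable abbrev basisElement (c : F.classes) : MatroidAlgebra k F := MonoidAlgebra.single c 1

/-- The comultiplication `M ↦ ∑_{A ⊆ E} M|_A ⊗ M/A`. -/
noncomputable def comul :
    MatroidAlgebra k F →ₗ[k] MatroidAlgebra k F ⊗[k] MatroidAlgebra k F :=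
  Finsupp.linearCombination k (fun c : F.classes =>
      (c.1.cutPairs.pmap (fun p (hp : p.1 ∈ F.classes ∧ p.2 ∈ F.classes) =>
        basisElement k F ⟨p.1, hp.1⟩ ⊗ₜ[k] basisElement k F ⟨p.2, hp.2⟩)
        (F.cutPairs_mem c.1 c.2)).sum) ∘ₗ
    (MonoidAlgebra.coeffLinearEquiv k).toLinearMap

/-- The counit, `M ↦ 1` if the ground set of `M` is empty and `M ↦ 0` otherwise. -/
noncomputable def counit : MatroidAlgebra k F →ₗ[k] k :=
  Finsupp.linearCombination k (fun c : F.classes => if c.1.size = 0 then (1 : k) else 0) ∘ₗ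
    (MonoidAlgebra.coeffLinearEquiv k).toLinearMap

/-- `S` is an antipode: `μ ∘ (S ⊗ id) ∘ Δ = η ∘ ε` and `μ ∘ (id ⊗ S) ∘ Δ = η ∘ ε`. -/
def IsAntipode (S : MatroidAlgebra k F →ₗ[k] MatroidAlgebra k F) : Prop :=
  LinearMap.mul' k (MatroidAlgebra k F) ∘ₗ TensorProduct.map S LinearMap.id ∘ₗ comul k F =
      Algebra.linearMap k (MatroidAlgebra k F) ∘ₗ counit k F ∧
    LinearMap.mul' k (MatroidAlgebra k F) ∘ₗ TensorProduct.map LinearMap.id S ∘ₗ comul k F =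
      Algebra.linearMap k (MatroidAlgebra k F) ∘ₗ counit k F

/-- The uniform matroid `U^r_I` as an element of the Hopf algebra. -/
noncomputable def uniformElement {E : Type u} (r : ℕ) (I : Finset E) : MatroidAlgebra k F :=
  basisElement k F ⟨(uniform r I).toClass, F.uniform_mem E r I⟩

end HopfAlgebra

/-! ## Ordered set partitions and the split-merge map -/

/-- An ordered set partition `(B_1, …, B_j)` of the finite set `E`. -/
@[ext]
structure OrderedSetPartition (E : Type u) [DecidableEq E] where
  parts : List (Finset E)
  nonempty : ∀ B ∈ parts, B.Nonempty
  disjoint : parts.Pairwise Disjoint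
  cover : ∀ x : E, ∃ B ∈ parts, x ∈ B

namespace OrderedSetPartition

variable {E : Type u} [LinearOrder E]

theorem nodup (π : OrderedSetPartition E) : π.parts.Nodup :=
  π.disjoint.imp_of_mem fun {B C} hB _ h hBC => by
    subst hBC
    exact (π.nonempty B hB).ne_empty (disjoint_self.1 h)

instance : DecidableEq (OrderedSetPartition E) := fun π ρ =>
  decidable_of_iff (π.parts = ρ.parts) OrderedSetPartition.ext_iff.symm

noncomputable instance [Fintype E] : Fintype (OrderedSetPartition E) :=
  Fintype.ofInjective (fun π => (⟨π.parts, π.nodup⟩ : {l : List (Finset E) // l.Nodup}))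
    fun _ _ h => OrderedSetPartition.ext (congrArg Subtype.val h)

/-- The part with index `i`, counted from `0` (and `∅` if there is no such part). -/
def part (π : OrderedSetPartition E) (i : ℕ) : Finset E := π.parts.getD i ∅

/-- The total size of the first `i` parts. -/
def partialSize (π : OrderedSetPartition E) (i : ℕ) : ℕ := ((π.parts.take i).map Finset.card).sum

/-- The index, counted from `0`, of the pivot part (the `ℓ`-th part): the first part at which the
total size of the parts up to and including it is at least `m`. -/
noncomputable def pivot (m : ℕ) (π : OrderedSetPartition E) : ℕ :=
  sInf {i | m ≤ π.partialSize (i + 1)}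

/-- The total size `k_1 + ⋯ + k_ℓ` of the parts up to and including the pivot part. -/
noncomputable def pivotSize (m : ℕ) (π : OrderedSetPartition E) : ℕ :=
  π.partialSize (π.pivot m + 1)

/-- The set `I` of elements of the parts before the pivot part. -/
noncomputable def setI (m : ℕ) (π : OrderedSetPartition E) : Finset E :=
  (π.parts.take (π.pivot m)).foldr (· ∪ ·) ∅

/-- The set `L`: the pivot part. -/
noncomputable def setL (m : ℕ) (π : OrderedSetPartition E) : Finset E := π.part (π.pivot m)

/-- The sign of `π`: `+1` or `-1` as the number of parts is even or odd. -/
def sgn (π : OrderedSetPartition E) : ℤ := (-1) ^ π.parts.length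

/-- The split-merge map splits the part with index `i` if it has more than one element, unless
it is the pivot part and `k_1 + ⋯ + k_ℓ > m`. -/
def CanSplit (m : ℕ) (π : OrderedSetPartition E) (i : ℕ) : Prop :=
  i < π.parts.length ∧ 1 < (π.part i).card ∧ (i ≠ π.pivot m ∨ π.pivotSize m = m)

/-- The split-merge map merges the part with index `i` with the next part if it is a singleton
whose element is larger than all elements of the next part, unless it is the pivot part, or the
next part is the pivot part and `k_1 + ⋯ + k_ℓ > m`. -/
def CanMerge (m : ℕ) (π : OrderedSetPartition E) (i : ℕ) : Prop :=
  i + 1 < π.parts.length ∧ (π.part i).card = 1 ∧ i ≠ π.pivot m ∧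
    (∀ x ∈ π.part i, ∀ y ∈ π.part (i + 1), y < x) ∧
    ¬ (i + 1 = π.pivot m ∧ m < π.pivotSize m)

theorem parts_eq_of_lt (π : OrderedSetPartition E) {i : ℕ} (h : i < π.parts.length) :
    π.parts = π.parts.take i ++ π.part i :: π.parts.drop (i + 1) := by
  rw [part, List.getD_eq_getElem _ _ h, List.getElem_cons_drop, List.take_append_drop]

theorem parts_eq_of_succ_lt (π : OrderedSetPartition E) {i : ℕ} (h : i + 1 < π.parts.length) :
    π.parts = π.parts.take i ++ π.part i :: π.part (i + 1) :: π.parts.drop (i + 2) := by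
  rw [part, part, List.getD_eq_getElem _ _ h, List.getElem_cons_drop,
    List.getD_eq_getElem _ _ (Nat.lt_of_succ_lt h), List.getElem_cons_drop, List.take_append_drop]

/-- Replace the part `B` with index `i` by the two parts `{max B}`, `B \ {max B}`. -/
def split (π : OrderedSetPartition E) (i : ℕ) (hi : i < π.parts.length)
    (hc : 1 < (π.part i).card) : OrderedSetPartition E :=
  let e : E := (π.part i).max' (Finset.card_pos.1 (Nat.zero_lt_of_lt hc))
  { parts := π.parts.take i ++ {e} :: (π.part i).erase e :: π.parts.drop (i + 1)
    nonempty := by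
      have h := π.nonempty
      rw [π.parts_eq_of_lt hi] at h
      have he : ((π.part i).erase e).Nonempty :=
        Finset.card_pos.1 (by rw [Finset.card_erase_of_mem (Finset.max'_mem _ _)]; omega)
      simp only [List.mem_append, List.mem_cons] at h ⊢
      rintro B (hB | rfl | rfl | hB)
      · exact h B (Or.inl hB)
      · exact Finset.singleton_nonempty _
      · exact he
      · exact h B (Or.inr (Or.inr hB))
    disjoint := by
      have h := π.disjoint
      rw [π.parts_eq_of_lt hi] at h
      have he : ({e} : Finset E) ⊆ π.part i := Finset.singleton_subset_iff.2 (Finset.max'_mem _ _)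
      have he' : (π.part i).erase e ⊆ π.part i := Finset.erase_subset _ _
      simp only [List.pairwise_append, List.pairwise_cons, List.mem_cons] at h ⊢
      obtain ⟨h1, ⟨h2, h3⟩, h4⟩ := h
      refine ⟨h1, ⟨?_, fun C hC => (h2 C hC).mono_left he', h3⟩, ?_⟩
      · rintro C (rfl | hC)
        · exact Finset.disjoint_singleton_left.2 (Finset.notMem_erase _ _)
        · exact (h2 C hC).mono_left he
      · rintro A hA C (rfl | rfl | hC)
        · exact (h4 A hA _ (Or.inl rfl)).mono_right he
        · exact (h4 A hA _ (Or.inl rfl)).mono_right he'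
        · exact h4 A hA C (Or.inr hC)
    cover := fun x => by
      obtain ⟨B, hB, hx⟩ := π.cover x
      rw [π.parts_eq_of_lt hi] at hB
      simp only [List.mem_append, List.mem_cons] at hB ⊢
      rcases hB with hB | rfl | hB
      · exact ⟨B, Or.inl hB, hx⟩
      · by_cases hxe : x = e
        · exact ⟨{e}, by simp, by simp [hxe]⟩
        · exact ⟨(π.part i).erase e, by simp, Finset.mem_erase.2 ⟨hxe, hx⟩⟩
      · exact ⟨B, by simp [hB], hx⟩ }

/-- Replace the parts with indices `i` and `i + 1` by their union. -/
def merge (π : OrderedSetPartition E) (i : ℕ) (hi : i + 1 < π.parts.length) :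
    OrderedSetPartition E where
  parts := π.parts.take i ++ (π.part i ∪ π.part (i + 1)) :: π.parts.drop (i + 2)
  nonempty := by
    have h := π.nonempty
    rw [π.parts_eq_of_succ_lt hi] at h
    simp only [List.mem_append, List.mem_cons] at h ⊢
    rintro B (hB | rfl | hB)
    · exact h B (Or.inl hB)
    · exact (h (π.part i) (by simp)).mono Finset.subset_union_left
    · exact h B (by simp [hB])
  disjoint := by
    have h := π.disjoint
    rw [π.parts_eq_of_succ_lt hi] at h
    simp only [List.pairwise_append, List.pairwise_cons, List.mem_cons] at h ⊢
    obtain ⟨h1, ⟨h2, h3, h4⟩, h5⟩ := h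
    refine ⟨h1, ⟨fun C hC => Finset.disjoint_union_left.2 ⟨h2 C (Or.inr hC), h3 C hC⟩, h4⟩, ?_⟩
    rintro A hA C (rfl | hC)
    · exact Finset.disjoint_union_right.2
        ⟨h5 A hA _ (Or.inl rfl), h5 A hA _ (Or.inr (Or.inl rfl))⟩
    · exact h5 A hA C (Or.inr (Or.inr hC))
  cover := fun x => by
    obtain ⟨B, hB, hx⟩ := π.cover x
    rw [π.parts_eq_of_succ_lt hi] at hB
    simp only [List.mem_append, List.mem_cons] at hB ⊢
    rcases hB with hB | rfl | rfl | hB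
    · exact ⟨B, Or.inl hB, hx⟩
    · exact ⟨_, Or.inr (Or.inl rfl), Finset.mem_union_left _ hx⟩
    · exact ⟨_, Or.inr (Or.inl rfl), Finset.mem_union_right _ hx⟩
    · exact ⟨B, by simp [hB], hx⟩

open Classical in
/-- The split-merge map `ι_<` for the rank `m`: going through the parts from left to right, it
splits or merges the first part to which splitting or merging applies, and it fixes `π` if there
is no such part. -/
noncomputable def splitMerge (m : ℕ) (π : OrderedSetPartition E) : OrderedSetPartition E :=
  if h : ∃ i, π.CanSplit m i ∨ π.CanMerge m i then
    if hs : π.CanSplit m (Nat.find h) then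
      π.split (Nat.find h) hs.1 hs.2.1
    else
      π.merge (Nat.find h) ((Nat.find_spec h).resolve_left hs).1
  else π

end OrderedSetPartition

end MatroidHopf

open MatroidHopf

namespace MatroidHopf

/-! ## Convolution of functions on isomorphism classes -/

/-! A linear map on the algebra is a function on isomorphism classes with values in a commutative
ring, and `μ ∘ (S ⊗ T) ∘ Δ` becomes the convolution `∑ f(M|_A) g(M/A)`. Convolution is associative
with unit `convolutionUnit` (`convolution_assoc`), so an antipode is a two-sided convolution inverse
of the identity, necessarily unique. It exists by Takeuchi's argument: with `f` the identity and `ε`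
the unit, `f - ε` vanishes on the empty matroid, so its `j`-th power vanishes on matroids with fewer
than `j` elements, and the series `∑ (-1)^j (f - ε)^j` is finite on each class and telescopes
against `f`.

On a uniform matroid the `j`-th power is a sum over ordered set partitions with `j` parts, because
minors of uniform matroids are uniform (`reducedPower_uniform`). In the product attached to a
partition, parts before the pivot are free and parts after it consist of loops. Free matroids add up
to a free matroid and loops to loops, so the product collapses to the three-factor term of the
formula (`minorProduct_eq`, `minorProduct_parts`).

This signed sum over all partitions is reduced by the split-merge map. A split at an index is undone
by a merge at the same index and conversely, and neither creates an earlier place to act, so the map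
is an involution (`splitMerge_involutive`). It changes the number of parts by one when it moves a
partition, and preserves the term (`partitionTerm_congr`). The partitions that are moved cancel in
pairs, leaving the fixed ones. -/

instance finite_restrict_finset {α : Type*} (M : Matroid α) (B : Finset α) :
    (M.restrict (B : Set α)).Finite :=
  ⟨B.finite_toSet⟩

/-- The isomorphism class of a finite matroid. -/
def matroidClass {α : Type u} (M : Matroid α) [hM : M.Finite] : MatroidClass.{u} :=
  (⟨α, M, hM⟩ : FinMatroid.{u}).toClass

/-- The ground set of a finite matroid, as a `Finset`. -/
noncomputable def groundFinset {α : Type*} (M : Matroid α) [M.Finite] : Finset α :=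
  M.ground_finite.toFinset

section Ground

variable {α : Type*} (M : Matroid α) [M.Finite]

theorem coe_groundFinset : (groundFinset M : Set α) = M.E :=
  Set.Finite.coe_toFinset _

theorem mem_groundFinset {x : α} : x ∈ groundFinset M ↔ x ∈ M.E :=
  Set.Finite.mem_toFinset _

theorem groundFinset_contract [DecidableEq α] (B : Finset α) :
    groundFinset (M.contract (B : Set α)) = groundFinset M \ B := by
  ext x
  simp [mem_groundFinset]

end Ground

theorem groundFinset_restrict {α : Type*} (M : Matroid α) (B : Finset α) :
    groundFinset (M.restrict (B : Set α)) = B := by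
  ext x
  simp [mem_groundFinset]

theorem matroidClass_congr {α : Type u} {M N : Matroid α} [M.Finite] [N.Finite] (h : M = N) :
    matroidClass M = matroidClass N := by
  subst h
  rfl

theorem MatroidClass.exists_rep (c : MatroidClass.{u}) :
    ∃ (α : Type u) (M : Matroid α) (_ : M.Finite), matroidClass M = c := by
  obtain ⟨⟨α, M, hM⟩⟩ := c
  exact ⟨α, M, hM, rfl⟩

theorem size_matroidClass {α : Type u} (M : Matroid α) [M.Finite] :
    (matroidClass M).size = (groundFinset M).card := rfl

theorem MatroidClass.eq_one_of_size_eq_zero {c : MatroidClass.{u}} (h : c.size = 0) : c = 1 := by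
  obtain ⟨α, M, hM, rfl⟩ := c.exists_rep
  have hE : M.E = ∅ := by
    rw [size_matroidClass, Finset.card_eq_zero] at h
    rw [← coe_groundFinset, h, Finset.coe_empty]
  have : IsEmpty M.E := by rw [hE]; infer_instance
  have : IsEmpty FinMatroid.empty.{u}.toMatroid.E := ⟨fun x => x.1.elim⟩
  refine Quotient.sound ⟨Equiv.equivOfIsEmpty _ _, fun I => ?_⟩
  have hI : I = ∅ := Set.eq_empty_of_isEmpty (α := M.E) I
  simp [hI]

theorem MatroidClass.size_one : (1 : MatroidClass.{u}).size = 0 := by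
  refine Finset.card_eq_zero.2 (Finset.eq_empty_of_forall_notMem fun x _ => x.elim)

section Convolution

variable {A : Type*} [CommRing A]

/-- The convolution product `c ↦ ∑ f(M|_A) g(M/A)`. -/
noncomputable def convolution (f g : MatroidClass.{u} → A) (c : MatroidClass.{u}) : A :=
  (c.cutPairs.map fun p => f p.1 * g p.2).sum

theorem convolution_matroidClass (f g : MatroidClass.{u} → A) {α : Type u} (M : Matroid α)
    [M.Finite] :
    convolution f g (matroidClass M) = ∑ B ∈ (groundFinset M).powerset,
      f (matroidClass (M.restrict (B : Set α))) * g (matroidClass (M.contract (B : Set α))) :=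
  congrArg Multiset.sum (Multiset.map_map _ _ _)

/-- Both sides sum over chains `C ⊆ B ⊆ E(M)`, with the three minors `M|_C`, `(M|_B)/C = (M/C)|_(B \
C)` and `M/B`. The right side indexes the chain by `C` and `B \ C`. -/
theorem convolution_assoc (f g h : MatroidClass.{u} → A) :
    convolution (convolution f g) h = convolution f (convolution g h) := by
  classical
  ext c
  obtain ⟨α, M, hM, rfl⟩ := c.exists_rep
  simp only [convolution_matroidClass, Finset.sum_mul, Finset.mul_sum, groundFinset_restrict,
    groundFinset_contract]
  rw [Finset.sum_sigma', Finset.sum_sigma']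
  refine Finset.sum_bij' (fun p _ => ⟨p.2, p.1 \ p.2⟩) (fun p _ => ⟨p.1 ∪ p.2, p.1⟩) ?_ ?_ ?_ ?_ ?_
  · rintro ⟨B, C⟩ hp
    simp only [Finset.mem_sigma, Finset.mem_powerset] at hp ⊢
    exact ⟨hp.2.trans hp.1, Finset.sdiff_subset_sdiff hp.1 le_rfl⟩
  · rintro ⟨B, C⟩ hp
    simp only [Finset.mem_sigma, Finset.mem_powerset] at hp ⊢
    exact ⟨Finset.union_subset hp.1 (hp.2.trans Finset.sdiff_subset), Finset.subset_union_left⟩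
  · rintro ⟨B, C⟩ hp
    simp only [Finset.mem_sigma, Finset.mem_powerset] at hp
    simp [Finset.union_eq_right.2 hp.2]
  · rintro ⟨B, C⟩ hp
    simp only [Finset.mem_sigma, Finset.mem_powerset, Finset.subset_sdiff] at hp
    simp [Finset.union_sdiff_cancel_left hp.2.2.symm]
  · rintro ⟨B, C⟩ hp
    simp only [Finset.mem_sigma, Finset.mem_powerset] at hp
    have hCB : (C : Set α) ⊆ B := Finset.coe_subset.2 hp.2
    have h1 := Matroid.restrict_restrict_eq M hCB
    have h2 : (M.restrict (B : Set α)).contract (C : Set α) =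
        (M.contract (C : Set α)).restrict ((B \ C : Finset α) : Set α) := by
      rw [Matroid.restrict_contract_eq_contract_restrict _ hCB, Finset.coe_sdiff]
    have h3 : (M.contract (C : Set α)).contract ((B \ C : Finset α) : Set α) =
        M.contract (B : Set α) := by
      rw [Matroid.contract_contract, ← Finset.coe_union, Finset.union_sdiff_of_subset hp.2]
    simp only [matroidClass_congr h1, matroidClass_congr h2, matroidClass_congr h3, mul_assoc]

/-- The unit of the convolution product. -/
noncomputable def convolutionUnit (c : MatroidClass.{u}) : A := if c.size = 0 then 1 else 0

theorem convolutionUnit_convolution (f : MatroidClass.{u} → A) :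
    convolution convolutionUnit f = f := by
  ext c
  obtain ⟨α, M, hM, rfl⟩ := c.exists_rep
  rw [convolution_matroidClass, Finset.sum_eq_single_of_mem ∅ (Finset.empty_mem_powerset _)]
  · rw [convolutionUnit, size_matroidClass, groundFinset_restrict, Finset.card_empty, if_pos rfl, one_mul]
    exact congrArg f (matroidClass_congr (by simp))
  · intro B _ hB
    simp [convolutionUnit, size_matroidClass, groundFinset_restrict, hB]

theorem convolution_convolutionUnit (f : MatroidClass.{u} → A) :
    convolution f convolutionUnit = f := by
  classical
  ext c
  obtain ⟨α, M, hM, rfl⟩ := c.exists_rep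
  rw [convolution_matroidClass,
    Finset.sum_eq_single_of_mem (groundFinset M) (Finset.mem_powerset.2 le_rfl)]
  · rw [convolutionUnit, size_matroidClass, groundFinset_contract, Finset.sdiff_self, Finset.card_empty,
      if_pos rfl, mul_one]
    exact congrArg f (matroidClass_congr (by simp [coe_groundFinset]))
  · intro B hB hne
    have : ¬ groundFinset M ⊆ B :=
      fun h => hne (Finset.Subset.antisymm (Finset.mem_powerset.1 hB) h)
    simp [convolutionUnit, size_matroidClass, groundFinset_contract, this]

theorem convolution_sub_left (f f' g : MatroidClass.{u} → A) :
    convolution (f - f') g = convolution f g - convolution f' g := by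
  ext c
  simp [convolution, sub_mul]

theorem convolution_sub_right (f g g' : MatroidClass.{u} → A) :
    convolution f (g - g') = convolution f g - convolution f g' := by
  ext c
  simp [convolution, mul_sub]

/-- The convolution powers of `f - ε`. -/
noncomputable def reducedPower (f : MatroidClass.{u} → A) : ℕ → MatroidClass.{u} → A
  | 0 => convolutionUnit
  | j + 1 => convolution (f - convolutionUnit) (reducedPower f j)

theorem convolution_reducedPower (f : MatroidClass.{u} → A) (j : ℕ) :
    convolution f (reducedPower f j) = reducedPower f (j + 1) + reducedPower f j := by
  rw [reducedPower, convolution_sub_left, convolutionUnit_convolution, sub_add_cancel]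

/-- The recursion puts the new factor `f - ε` on the left; associativity moves it to the right. -/
theorem reducedPower_convolution (f : MatroidClass.{u} → A) (j : ℕ) :
    convolution (reducedPower f j) f = reducedPower f (j + 1) + reducedPower f j := by
  have h : ∀ j, convolution (reducedPower f j) (f - convolutionUnit) = reducedPower f (j + 1) := by
    intro j
    induction j with
    | zero => simp only [reducedPower, convolutionUnit_convolution, convolution_convolutionUnit]
    | succ j ih => rw [reducedPower, convolution_assoc, ih]; rfl
  rw [← h, convolution_sub_right, convolution_convolutionUnit, sub_add_cancel]

/-- Since `f - ε` kills the empty matroid, a nonzero summand needs `j` successive nonempty pieces of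
the ground set, hence at least `j` elements. -/
theorem reducedPower_eq_zero {f : MatroidClass.{u} → A} (hf : f 1 = 1) {j : ℕ}
    {c : MatroidClass.{u}} (hc : c.size < j) : reducedPower f j c = 0 := by
  classical
  induction j generalizing c with
  | zero => omega
  | succ j ih =>
    obtain ⟨α, M, hM, rfl⟩ := c.exists_rep
    rw [size_matroidClass] at hc
    rw [reducedPower, convolution_matroidClass]
    refine Finset.sum_eq_zero fun B hB => ?_
    obtain rfl | hne := B.eq_empty_or_nonempty
    · have h0 : (matroidClass (M.restrict ((∅ : Finset α) : Set α))).size = 0 := by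
        rw [size_matroidClass, groundFinset_restrict, Finset.card_empty]
      rw [MatroidClass.eq_one_of_size_eq_zero h0, Pi.sub_apply, hf, convolutionUnit,
        if_pos MatroidClass.size_one, sub_self, zero_mul]
    · rw [ih, mul_zero]
      have hB' := Finset.mem_powerset.1 hB
      rw [size_matroidClass, groundFinset_contract, Finset.card_sdiff_of_subset hB']
      have := hne.card_pos
      have := Finset.card_le_card hB'
      omega

/-- Takeuchi's formula for the convolution inverse of `f`. -/
noncomputable def convolutionInverse (f : MatroidClass.{u} → A) (c : MatroidClass.{u}) : A :=
  ∑ j ∈ Finset.range (c.size + 1), (-1) ^ j * reducedPower f j c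

/-- Allows one truncation bound for all minors of a matroid, so that the sums over `j` and over
subsets can be interchanged. -/
theorem convolutionInverse_eq_sum {f : MatroidClass.{u} → A} (hf : f 1 = 1) {c : MatroidClass.{u}}
    {N : ℕ} (hN : c.size < N) :
    convolutionInverse f c = ∑ j ∈ Finset.range N, (-1) ^ j * reducedPower f j c := by
  refine Finset.sum_subset (by simpa using hN) fun j _ hj => ?_
  rw [reducedPower_eq_zero hf (by simpa using hj), mul_zero]

theorem sum_reducedPower_telescope {f : MatroidClass.{u} → A} (hf : f 1 = 1)
    {c : MatroidClass.{u}} {N : ℕ} (hN : c.size < N) :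
    ∑ j ∈ Finset.range N, (-1) ^ j * (reducedPower f (j + 1) + reducedPower f j) c =
      convolutionUnit c := by
  have h : ∀ N, ∑ j ∈ Finset.range N, (-1) ^ j * (reducedPower f (j + 1) + reducedPower f j) c =
      convolutionUnit c - (-1) ^ N * reducedPower f N c := by
    intro N
    induction N with
    | zero => simp [reducedPower]
    | succ N ih => rw [Finset.sum_range_succ, ih, Pi.add_apply]; ring
  rw [h, reducedPower_eq_zero hf hN, mul_zero, sub_zero]

theorem convolution_convolutionInverse {f : MatroidClass.{u} → A} (hf : f 1 = 1) :
    convolution f (convolutionInverse f) = convolutionUnit := by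
  classical
  ext c
  obtain ⟨α, M, hM, rfl⟩ := c.exists_rep
  rw [← sum_reducedPower_telescope hf (Nat.lt_succ_self _)]
  simp_rw [← convolution_reducedPower]
  simp_rw [convolution_matroidClass, Finset.mul_sum]
  rw [Finset.sum_comm]
  refine Finset.sum_congr rfl fun B _ => ?_
  rw [convolutionInverse_eq_sum hf (N := (matroidClass M).size + 1), Finset.mul_sum]
  · exact Finset.sum_congr rfl fun j _ => by ring
  · rw [size_matroidClass, size_matroidClass, groundFinset_contract]
    exact Nat.lt_succ_of_le (Finset.card_le_card Finset.sdiff_subset)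

theorem convolutionInverse_convolution {f : MatroidClass.{u} → A} (hf : f 1 = 1) :
    convolution (convolutionInverse f) f = convolutionUnit := by
  ext c
  obtain ⟨α, M, hM, rfl⟩ := c.exists_rep
  rw [← sum_reducedPower_telescope hf (Nat.lt_succ_self _)]
  simp_rw [← reducedPower_convolution]
  simp_rw [convolution_matroidClass, Finset.mul_sum]
  rw [Finset.sum_comm]
  refine Finset.sum_congr rfl fun B hB => ?_
  rw [convolutionInverse_eq_sum hf (N := (matroidClass M).size + 1), Finset.sum_mul]
  · exact Finset.sum_congr rfl fun j _ => by ring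
  · rw [size_matroidClass, size_matroidClass, groundFinset_restrict]
    exact Nat.lt_succ_of_le (Finset.card_le_card (Finset.mem_powerset.1 hB))

/-- Identities that are known only for classes in the family suffice, because the family is closed
under minors. -/
theorem convolution_congr {f f' g g' : MatroidClass.{u} → A} {c : MatroidClass.{u}}
    (h : ∀ p ∈ c.cutPairs, f p.1 = f' p.1 ∧ g p.2 = g' p.2) :
    convolution f g c = convolution f' g' c := by
  refine congrArg Multiset.sum (Multiset.map_congr rfl fun p hp => ?_)
  rw [(h p hp).1, (h p hp).2]

end Convolution

/-! ## Existence and uniqueness of the antipode -/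

section Antipode

variable (k : Type*) [Field k] (F : MatroidFamily.{u})

open Classical in
/-- The values of a linear map on the basis, extended by zero to all isomorphism classes. -/
noncomputable def extendedValues (S : MatroidAlgebra k F →ₗ[k] MatroidAlgebra k F)
    (c : MatroidClass.{u}) : MatroidAlgebra k F :=
  if h : c ∈ F.classes then S (basisElement k F ⟨c, h⟩) else 0

theorem extendedValues_of_mem (S : MatroidAlgebra k F →ₗ[k] MatroidAlgebra k F)
    (c : F.classes) : extendedValues k F S c.1 = S (basisElement k F c) :=
  dif_pos c.2

theorem extendedValues_id_one : extendedValues k F LinearMap.id 1 = 1 :=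
  extendedValues_of_mem k F LinearMap.id 1

theorem mul'_map_comul (S T : MatroidAlgebra k F →ₗ[k] MatroidAlgebra k F) (c : F.classes) :
    (LinearMap.mul' k (MatroidAlgebra k F) ∘ₗ TensorProduct.map S T ∘ₗ comul k F)
      (basisElement k F c) = convolution (extendedValues k F S) (extendedValues k F T) c.1 := by
  have h : comul k F (basisElement k F c) =
      (c.1.cutPairs.pmap (fun p (hp : p.1 ∈ F.classes ∧ p.2 ∈ F.classes) =>
        basisElement k F ⟨p.1, hp.1⟩ ⊗ₜ[k] basisElement k F ⟨p.2, hp.2⟩)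
        (F.cutPairs_mem c.1 c.2)).sum := by
    simp [comul, basisElement]
  rw [LinearMap.comp_apply, LinearMap.comp_apply, h, map_multiset_sum, map_multiset_sum,
    Multiset.map_map, Multiset.map_pmap, convolution,
    ← Multiset.pmap_eq_map _ _ _ (F.cutPairs_mem c.1 c.2)]
  refine congrArg Multiset.sum (Multiset.pmap_congr _ fun p _ hp _ => ?_)
  rw [Function.comp_apply, TensorProduct.map_tmul, LinearMap.mul'_apply,
    extendedValues_of_mem k F S ⟨p.1, hp.1⟩, extendedValues_of_mem k F T ⟨p.2, hp.2⟩]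

theorem linearMap_counit (c : F.classes) :
    (Algebra.linearMap k (MatroidAlgebra k F) ∘ₗ counit k F) (basisElement k F c) =
      convolutionUnit c.1 := by
  have h : counit k F (basisElement k F c) = if c.1.size = 0 then (1 : k) else 0 := by
    simp [counit, basisElement]
  rw [LinearMap.comp_apply, h, convolutionUnit]
  split_ifs
  · exact map_one (algebraMap k (MatroidAlgebra k F))
  · exact map_zero _

theorem linearMap_ext {V : Type*} [AddCommMonoid V] [Module k V]
    {S T : MatroidAlgebra k F →ₗ[k] V}
    (h : ∀ c : F.classes, S (basisElement k F c) = T (basisElement k F c)) : S = T := by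
  refine MonoidAlgebra.lhom_ext' fun c => LinearMap.ext_ring ?_
  exact h c

theorem isAntipode_iff (S : MatroidAlgebra k F →ₗ[k] MatroidAlgebra k F) :
    IsAntipode k F S ↔
      (∀ c ∈ F.classes, convolution (extendedValues k F S) (extendedValues k F LinearMap.id) c =
        convolutionUnit c) ∧
      (∀ c ∈ F.classes, convolution (extendedValues k F LinearMap.id) (extendedValues k F S) c =
        convolutionUnit c) := by
  refine and_congr ⟨fun h c hc => ?_, fun h => linearMap_ext k F fun c => ?_⟩
    ⟨fun h c hc => ?_, fun h => linearMap_ext k F fun c => ?_⟩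
  · exact ((mul'_map_comul k F _ _ ⟨c, hc⟩).symm.trans (LinearMap.congr_fun h _)).trans
      (linearMap_counit k F ⟨c, hc⟩)
  · rw [mul'_map_comul, linearMap_counit, h c.1 c.2]
  · exact ((mul'_map_comul k F _ _ ⟨c, hc⟩).symm.trans (LinearMap.congr_fun h _)).trans
      (linearMap_counit k F ⟨c, hc⟩)
  · rw [mul'_map_comul, linearMap_counit, h c.1 c.2]

/-- The antipode, given by Takeuchi's formula. -/
noncomputable def antipode : MatroidAlgebra k F →ₗ[k] MatroidAlgebra k F :=
  Finsupp.linearCombination k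
      (fun c : F.classes => convolutionInverse (extendedValues k F LinearMap.id) c.1) ∘ₗ
    (MonoidAlgebra.coeffLinearEquiv k).toLinearMap

theorem antipode_basisElement (c : F.classes) :
    antipode k F (basisElement k F c) =
      convolutionInverse (extendedValues k F LinearMap.id) c.1 := by
  simp [antipode, basisElement]

theorem extendedValues_antipode {c : MatroidClass.{u}} (hc : c ∈ F.classes) :
    extendedValues k F (antipode k F) c =
      convolutionInverse (extendedValues k F LinearMap.id) c :=
  (extendedValues_of_mem k F _ ⟨c, hc⟩).trans (antipode_basisElement k F ⟨c, hc⟩)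

theorem isAntipode_antipode : IsAntipode k F (antipode k F) := by
  refine (isAntipode_iff k F _).2 ⟨fun c hc => ?_, fun c hc => ?_⟩
  · rw [← convolutionInverse_convolution (extendedValues_id_one k F)]
    exact convolution_congr fun p hp =>
      ⟨extendedValues_antipode k F (F.cutPairs_mem c hc p hp).1, rfl⟩
  · rw [← convolution_convolutionInverse (extendedValues_id_one k F)]
    exact convolution_congr fun p hp =>
      ⟨rfl, extendedValues_antipode k F (F.cutPairs_mem c hc p hp).2⟩

/-- Uniqueness of inverses in a monoid: with `g` the inverse of the identity `f`, `S = S * (f * g) =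
(S * f) * g = g`. -/
theorem IsAntipode.eq_antipode {S : MatroidAlgebra k F →ₗ[k] MatroidAlgebra k F}
    (hS : IsAntipode k F S) : S = antipode k F := by
  refine linearMap_ext k F fun c => ?_
  rw [antipode_basisElement, ← extendedValues_of_mem,
    ← convolution_convolutionUnit (extendedValues k F S),
    ← convolution_convolutionInverse (extendedValues_id_one k F), ← convolution_assoc]
  conv_rhs => rw [← convolutionUnit_convolution (convolutionInverse _)]
  exact convolution_congr fun p hp =>
    ⟨((isAntipode_iff k F S).1 hS).1 p.1 (F.cutPairs_mem c.1 c.2 p hp).1, rfl⟩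

end Antipode

end MatroidHopf

namespace MatroidHopf

/-! ## Minors and sums of uniform matroids -/

/-- The uniform matroid `U^r_I` as a matroid on the ambient type. -/
def uniformOn {E : Type u} (r : ℕ) (I : Finset E) : Matroid E := (uniform r I).toMatroid

instance {E : Type u} (r : ℕ) (I : Finset E) : (uniformOn r I).Finite := (uniform r I).finite

section Uniform

variable {E E' : Type u}

theorem uniformOn_ground (r : ℕ) (I : Finset E) : (uniformOn r I).E = I := rfl

theorem uniformOn_indep_iff {r : ℕ} {I : Finset E} {X : Set E} :
    (uniformOn r I).Indep X ↔ X ⊆ I ∧ X.ncard ≤ r := Iff.rfl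

theorem groundFinset_uniformOn (r : ℕ) (I : Finset E) : groundFinset (uniformOn r I) = I := by
  ext x
  simp [mem_groundFinset, uniformOn_ground]

theorem uniformOn_restrict {r : ℕ} {I B : Finset E} (h : B ⊆ I) :
    (uniformOn r I).restrict (B : Set E) = uniformOn r B := by
  refine Matroid.ext_indep rfl fun X _ => ?_
  rw [Matroid.restrict_indep_iff, uniformOn_indep_iff, uniformOn_indep_iff]
  exact ⟨fun hX => ⟨hX.2, hX.1.2⟩, fun hX => ⟨⟨hX.1.trans (Finset.coe_subset.2 h), hX.2⟩, hX.1⟩⟩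

/-- A basis `K` of `B` is either all of `B` or has `r` elements. Disjoint `X` is independent in the
contraction iff `|X| + |K| ≤ r`; in the second case `|B| ≥ r`, and the truncated difference `r -
|B|` is correctly `0`. -/
theorem uniformOn_contract [DecidableEq E] {r : ℕ} {I B : Finset E} (h : B ⊆ I) :
    (uniformOn r I).contract (B : Set E) = uniformOn (r - B.card) (I \ B) := by
  obtain ⟨K, hK⟩ := (uniformOn r I).exists_isBasis (B : Set E) (Finset.coe_subset.2 h)
  have hKfin : K.Finite := B.finite_toSet.subset hK.subset
  have hKr := (uniformOn_indep_iff.1 hK.indep).2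
  have hKB : K.ncard ≤ B.card := by
    rw [← Set.ncard_coe_finset]
    exact Set.ncard_le_ncard hK.subset B.finite_toSet
  have hK' : K.ncard = B.card ∨ K.ncard = r := by
    by_contra! hne
    have hlt : K.ncard < (B : Set E).ncard := by rw [Set.ncard_coe_finset]; omega
    obtain ⟨e, heB, heK⟩ := Set.exists_mem_notMem_of_ncard_lt_ncard hlt hKfin
    refine heK (hK.mem_of_insert_indep heB (uniformOn_indep_iff.2 ⟨?_, ?_⟩))
    · exact Set.insert_subset (h heB) (hK.subset.trans (Finset.coe_subset.2 h))
    · rw [Set.ncard_insert_of_notMem heK hKfin]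
      omega
  refine Matroid.ext_indep (by simp [uniformOn_ground]) fun X hX => ?_
  rw [Matroid.contract_ground, uniformOn_ground, ← Finset.coe_sdiff] at hX
  have hXI : X ⊆ I := hX.trans (Finset.coe_subset.2 Finset.sdiff_subset)
  have hXB : Disjoint (B : Set E) X := by
    rw [Finset.coe_sdiff] at hX
    exact (Set.subset_sdiff.1 hX).2.symm
  have hXfin : X.Finite := I.finite_toSet.subset hXI
  rw [hK.contract_indep_iff_of_disjoint hXB, uniformOn_indep_iff, uniformOn_indep_iff,
    Set.ncard_union_eq (hXB.mono_left hK.subset).symm hXfin hKfin]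
  have hKI : K ⊆ I := hK.subset.trans (Finset.coe_subset.2 h)
  simp only [Set.union_subset_iff, hXI, hKI, hX, true_and]
  omega

/-- Independence depends only on cardinality, so any bijection is an isomorphism. Once the rank
bound reaches the number of elements the matroid is free, and the two bounds may differ. -/
theorem matroidClass_uniformOn_eq {r s : ℕ} {I : Finset E} {J : Finset E'} (hc : I.card = J.card)
    (h : r = s ∨ I.card ≤ r ∧ J.card ≤ s) :
    matroidClass (uniformOn r I) = matroidClass (uniformOn s J) := by
  let e : I ≃ J := Finset.equivOfCardEq hc
  suffices key : ∀ X : Set I, (uniformOn r I).Indep (Subtype.val '' X) ↔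
      (uniformOn s J).Indep (Subtype.val '' (e '' X)) from Quotient.sound ⟨e, key⟩
  intro X
  rw [uniformOn_indep_iff, uniformOn_indep_iff, Set.ncard_image_of_injective _ e.injective |>
    (Set.ncard_image_of_injective (e '' X) Subtype.val_injective).trans,
    Set.ncard_image_of_injective _ Subtype.val_injective,
    and_iff_right (by rintro _ ⟨x, -, rfl⟩; exact x.2),
    and_iff_right (by rintro _ ⟨x, -, rfl⟩; exact x.2)]
  have hX : X.ncard ≤ I.card := by
    have := Set.ncard_le_ncard (Set.subset_univ X) Set.finite_univ
    simpa [Set.ncard_univ] using this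
  omega

/-- The isomorphism class of the uniform matroid `U^r_n`. -/
noncomputable def uniformClass (r n : ℕ) : MatroidClass.{u} :=
  matroidClass (uniformOn r (Finset.univ : Finset (ULift.{u} (Fin n))))

theorem matroidClass_uniformOn (r : ℕ) (I : Finset E) :
    matroidClass (uniformOn r I) = uniformClass r I.card :=
  matroidClass_uniformOn_eq (by simp) (Or.inl rfl)

theorem uniformClass_eq {r s n : ℕ} (hr : n ≤ r) (hs : n ≤ s) :
    uniformClass.{u} r n = uniformClass s n :=
  matroidClass_uniformOn_eq rfl (Or.inr (by simp [hr, hs]))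

/-- One of the two extreme cases in which the sum is again uniform: every subset is independent. The
other is `uniformOn_sum_zero`, where only `∅` is. -/
theorem uniformOn_sum_free (I : Finset E) (J : Finset E') :
    (uniformOn I.card I).sum (uniformOn J.card J) =
      uniformOn (I.disjSum J).card (I.disjSum J) := by
  refine Matroid.ext_indep ?_ fun X hX => ?_
  · ext (x | x) <;> simp [uniformOn_ground]
  · have hX' : X ⊆ (I.disjSum J : Finset (E ⊕ E')) := by
      refine hX.trans (le_of_eq ?_)
      ext (x | x) <;> simp [uniformOn_ground]
    rw [Matroid.sum_indep_iff, uniformOn_indep_iff, uniformOn_indep_iff, uniformOn_indep_iff]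
    have h1 : Sum.inl ⁻¹' X ⊆ (I : Set E) := fun x hx => by simpa using hX' hx
    have h2 : Sum.inr ⁻¹' X ⊆ (J : Set E') := fun x hx => by simpa using hX' hx
    have hle {α : Type u} {Y : Set α} {K : Finset α} (h : Y ⊆ (K : Set α)) : Y.ncard ≤ K.card := by
      rw [← Set.ncard_coe_finset]
      exact Set.ncard_le_ncard h K.finite_toSet
    exact iff_of_true ⟨⟨h1, hle h1⟩, h2, hle h2⟩ ⟨hX', hle hX'⟩

theorem uniformOn_sum_zero (I : Finset E) (J : Finset E') :
    (uniformOn 0 I).sum (uniformOn 0 J) = uniformOn 0 (I.disjSum J) := by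
  have h0 {α : Type u} {Y : Set α} {K : Finset α} : (uniformOn 0 K).Indep Y ↔ Y = ∅ := by
    rw [uniformOn_indep_iff]
    refine ⟨fun h => ?_, fun h => by simp [h]⟩
    exact (Set.ncard_eq_zero (K.finite_toSet.subset h.1)).1 (Nat.le_zero.1 h.2)
  refine Matroid.ext_indep ?_ fun X hX => ?_
  · ext (x | x) <;> simp [uniformOn_ground]
  · rw [Matroid.sum_indep_iff, h0, h0, h0]
    refine ⟨fun h => ?_, fun h => by simp [h]⟩
    refine Set.eq_empty_iff_forall_notMem.2 ?_
    rintro (x | x) hx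
    · exact Set.eq_empty_iff_forall_notMem.1 h.1 x hx
    · exact Set.eq_empty_iff_forall_notMem.1 h.2 x hx

theorem matroidClass_mul {M : Matroid E} {N : Matroid E'} [hM : M.Finite] [hN : N.Finite]
    {P : Matroid (E ⊕ E')} [P.Finite] (h : M.sum N = P) :
    matroidClass M * matroidClass N = matroidClass P := by
  subst h
  rfl

theorem uniformClass_free_mul (a b : ℕ) :
    uniformClass.{u} a a * uniformClass b b = uniformClass (a + b) (a + b) := by
  have h := matroidClass_mul (uniformOn_sum_free (Finset.univ : Finset (ULift.{u} (Fin a)))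
    (Finset.univ : Finset (ULift.{u} (Fin b))))
  simpa only [matroidClass_uniformOn, Finset.card_disjSum, Finset.card_univ, Fintype.card_ulift,
    Fintype.card_fin] using h

theorem uniformClass_zero_mul (a b : ℕ) :
    uniformClass.{u} 0 a * uniformClass 0 b = uniformClass 0 (a + b) := by
  have h := matroidClass_mul (uniformOn_sum_zero (Finset.univ : Finset (ULift.{u} (Fin a)))
    (Finset.univ : Finset (ULift.{u} (Fin b))))
  simpa only [matroidClass_uniformOn, Finset.card_disjSum, Finset.card_univ, Fintype.card_ulift,
    Fintype.card_fin] using h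

theorem size_uniformClass (r n : ℕ) : (uniformClass.{u} r n).size = n := by
  rw [uniformClass, size_matroidClass, groundFinset_uniformOn]
  simp

theorem uniformClass_card_zero (r : ℕ) : uniformClass.{u} r 0 = 1 :=
  MatroidClass.eq_one_of_size_eq_zero (size_uniformClass r 0)

end Uniform

/-! ## Takeuchi's formula for uniform matroids -/

/-! ### Ordered set partitions as lists -/

section Lists

variable {E : Type u} [DecidableEq E]

/-- The ordered partitions of a finite set into `j` parts, as lists. -/
def partitionLists : ℕ → Finset E → Finset (List (Finset E))
  | 0, X => if X = ∅ then {[]} else ∅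
  | j + 1, X => (X.powerset.erase ∅).biUnion fun B => (partitionLists j (X \ B)).image (B :: ·)

theorem mem_partitionLists {j : ℕ} {X : Finset E} {l : List (Finset E)} :
    l ∈ partitionLists j X ↔ l.length = j ∧ (∀ B ∈ l, B.Nonempty) ∧ l.Pairwise Disjoint ∧
      ∀ x, x ∈ X ↔ ∃ B ∈ l, x ∈ B := by
  induction j generalizing X l with
  | zero =>
    rw [partitionLists]
    split_ifs with h
    · subst h
      rw [Finset.mem_singleton]
      constructor
      · rintro rfl
        simp
      · exact fun hl => List.length_eq_zero_iff.1 hl.1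
    · refine iff_of_false (Finset.notMem_empty _) fun hl => h ?_
      obtain rfl := List.length_eq_zero_iff.1 hl.1
      exact Finset.eq_empty_of_forall_notMem fun x hx => by simpa using (hl.2.2.2 x).1 hx
  | succ j ih =>
    simp only [partitionLists, Finset.mem_biUnion, Finset.mem_erase, Finset.mem_powerset,
      Finset.mem_image, ih]
    constructor
    · rintro ⟨B, ⟨hne, hB⟩, l, ⟨h1, h2, h3, h4⟩, rfl⟩
      refine ⟨by simp [h1], ?_, List.pairwise_cons.2 ⟨fun C hC => ?_, h3⟩, fun x => ?_⟩
      · simpa using ⟨Finset.nonempty_iff_ne_empty.2 hne, h2⟩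
      · refine Finset.disjoint_right.2 fun x hx => ?_
        exact (Finset.mem_sdiff.1 ((h4 x).2 ⟨C, hC, hx⟩)).2
      · have := h4 x
        rw [Finset.mem_sdiff] at this
        simp only [List.mem_cons, exists_eq_or_imp, ← this]
        have := @hB x
        tauto
    · rintro ⟨h1, h2, h3, h4⟩
      cases l with
      | nil => simp at h1
      | cons B l =>
        simp only [List.mem_cons, exists_eq_or_imp, forall_eq_or_imp, List.pairwise_cons] at h2 h3 h4
        refine ⟨B, ⟨Finset.nonempty_iff_ne_empty.1 h2.1, fun x hx => (h4 x).2 (Or.inl hx)⟩, l,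
          ⟨by simpa using h1, h2.2, h3.2, fun x => ?_⟩, rfl⟩
        rw [Finset.mem_sdiff, h4 x]
        constructor
        · tauto
        · rintro ⟨C, hC, hx⟩
          exact ⟨Or.inr ⟨C, hC, hx⟩, Finset.disjoint_right.1 (h3.1 C hC) hx⟩

theorem sum_partitionLists_succ {A : Type*} [AddCommMonoid A] (w : List (Finset E) → A) (j : ℕ)
    (X : Finset E) :
    ∑ l ∈ partitionLists (j + 1) X, w l =
      ∑ B ∈ X.powerset.erase ∅, ∑ l ∈ partitionLists j (X \ B), w (B :: l) := by
  rw [partitionLists, Finset.sum_biUnion]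
  · refine Finset.sum_congr rfl fun B _ => ?_
    rw [Finset.sum_image (fun l _ l' _ h => (List.cons.inj h).2)]
  · intro B _ C _ hBC
    refine Finset.disjoint_left.2 fun l hl hl' => hBC ?_
    obtain ⟨_, -, rfl⟩ := Finset.mem_image.1 hl
    obtain ⟨_, -, h⟩ := Finset.mem_image.1 hl'
    exact (List.cons.inj h).1.symm

end Lists

/-! ### Iterated minors of a uniform matroid -/

section Takeuchi

variable (k : Type*) [Field k] (F : MatroidFamily.{u})

/-- The class of the uniform matroid `U^r_n` as a basis element. -/
noncomputable def uniformBasis (r n : ℕ) : MatroidAlgebra k F :=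
  extendedValues k F LinearMap.id (uniformClass r n)

theorem uniformClass_mem (r n : ℕ) : uniformClass r n ∈ F.classes := F.uniform_mem _ _ _

theorem uniformElement_eq {E : Type u} (r : ℕ) (I : Finset E) :
    uniformElement k F r I = uniformBasis k F r I.card := by
  rw [uniformBasis, ← matroidClass_uniformOn]
  exact (extendedValues_of_mem k F LinearMap.id ⟨_, F.uniform_mem E r I⟩).symm

theorem extendedValues_id_mul {c d : MatroidClass.{u}} (hc : c ∈ F.classes) (hd : d ∈ F.classes) :
    extendedValues k F LinearMap.id c * extendedValues k F LinearMap.id d =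
      extendedValues k F LinearMap.id (c * d) := by
  rw [extendedValues_of_mem k F LinearMap.id ⟨c, hc⟩, extendedValues_of_mem k F LinearMap.id ⟨d, hd⟩,
    extendedValues_of_mem k F LinearMap.id ⟨c * d, F.classes.mul_mem hc hd⟩]
  simp [basisElement, MonoidAlgebra.single_mul_single]

theorem uniformBasis_free_mul (a b : ℕ) :
    uniformBasis k F a a * uniformBasis k F b b = uniformBasis k F (a + b) (a + b) := by
  rw [uniformBasis, uniformBasis, extendedValues_id_mul k F (uniformClass_mem F _ _)
    (uniformClass_mem F _ _), uniformClass_free_mul, uniformBasis]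

theorem uniformBasis_zero_mul (a b : ℕ) :
    uniformBasis k F 0 a * uniformBasis k F 0 b = uniformBasis k F 0 (a + b) := by
  rw [uniformBasis, uniformBasis, extendedValues_id_mul k F (uniformClass_mem F _ _)
    (uniformClass_mem F _ _), uniformClass_zero_mul, uniformBasis]

theorem uniformBasis_eq {r s n : ℕ} (hr : n ≤ r) (hs : n ≤ s) :
    uniformBasis k F r n = uniformBasis k F s n :=
  congrArg _ (uniformClass_eq hr hs)

theorem uniformBasis_card_zero (r : ℕ) : uniformBasis k F r 0 = 1 := by
  rw [uniformBasis, uniformClass_card_zero, extendedValues_id_one]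

/-- The product of the uniform matroids `U^{r - (n_1 + ⋯ + n_{i-1})}_{n_i}`, the iterated minors
of a uniform matroid of rank `r`. -/
noncomputable def minorProduct : ℕ → List ℕ → MatroidAlgebra k F
  | _, [] => 1
  | r, n :: l => uniformBasis k F r n * minorProduct (r - n) l

/-- Cutting off the first part `B` leaves `U^r_B` and the uniform matroid `U^{r-|B|}_{X \ B}`, to
which the induction applies. The summand `B = ∅` vanishes because `f - ε` kills the empty matroid.
-/
theorem reducedPower_uniform {E : Type u} [DecidableEq E] (j r : ℕ) (X : Finset E) :
    reducedPower (extendedValues k F LinearMap.id) j (matroidClass (uniformOn r X)) =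
      ∑ l ∈ partitionLists j X, minorProduct k F r (l.map Finset.card) := by
  induction j generalizing r X with
  | zero =>
    rw [reducedPower, partitionLists, convolutionUnit, size_matroidClass, groundFinset_uniformOn]
    by_cases hX : X = ∅ <;> simp [hX, minorProduct]
  | succ j ih =>
    rw [reducedPower, convolution_matroidClass, groundFinset_uniformOn, sum_partitionLists_succ]
    refine (Finset.sum_subset_zero_on_sdiff (Finset.erase_subset _ _) ?_ ?_).symm
    · intro B hB
      obtain rfl : B = ∅ := by
        by_contra hne
        exact (Finset.mem_sdiff.1 hB).2 (Finset.mem_erase.2 ⟨hne, (Finset.mem_sdiff.1 hB).1⟩)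
      rw [matroidClass_congr (uniformOn_restrict (Finset.empty_subset X)), matroidClass_uniformOn,
        Finset.card_empty, uniformClass_card_zero, Pi.sub_apply, extendedValues_id_one,
        convolutionUnit, if_pos MatroidClass.size_one, sub_self, zero_mul]
    · intro B hB
      obtain ⟨hne, hB⟩ := Finset.mem_erase.1 hB
      have hBX := Finset.mem_powerset.1 hB
      rw [matroidClass_congr (uniformOn_restrict hBX), matroidClass_congr (uniformOn_contract hBX),
        ih, matroidClass_uniformOn, Pi.sub_apply, convolutionUnit, size_uniformClass,
        if_neg (by simpa using hne), sub_zero, Finset.mul_sum]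
      rfl

theorem minorProduct_zero (l : List ℕ) : minorProduct k F 0 l = uniformBasis k F 0 l.sum := by
  induction l with
  | nil => rw [minorProduct, List.sum_nil, uniformBasis_card_zero]
  | cons n l ih => rw [minorProduct, Nat.zero_sub, ih, uniformBasis_zero_mul, List.sum_cons]

/-- Blocks before `i` fit inside the remaining rank and are free; blocks after `i` have remaining
rank `0`. The alternative `i = 0` is needed for `r = 0`, where no strict inequality can hold. -/
theorem minorProduct_eq (r : ℕ) (l : List ℕ) (i : ℕ) (hi : i < l.length)
    (h : i = 0 ∨ (l.take i).sum < r) (h' : r ≤ (l.take (i + 1)).sum) :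
    minorProduct k F r l = uniformBasis k F (l.take i).sum (l.take i).sum *
      uniformBasis k F (r - (l.take i).sum) ((l.take (i + 1)).sum - (l.take i).sum) *
        uniformBasis k F 0 (l.sum - (l.take (i + 1)).sum) := by
  induction l generalizing r i with
  | nil => simp at hi
  | cons n l ih =>
    cases i with
    | zero =>
      have h'' : r - n = 0 := by simpa [Nat.sub_eq_zero_iff_le] using h'
      simp [minorProduct, h'', minorProduct_zero, uniformBasis_card_zero]
    | succ i =>
      simp only [List.take_succ_cons, List.sum_cons, List.length_cons] at h h' hi ⊢
      have hr : n + (l.take i).sum < r := h.resolve_left (by omega)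
      rw [minorProduct, ih (r - n) i (by omega) (by omega) (by omega), ← uniformBasis_free_mul,
        uniformBasis_eq k F (le_refl n) (show n ≤ r by omega), Nat.add_sub_add_left,
        Nat.add_sub_add_left, Nat.sub_sub]
      ring

end Takeuchi

end MatroidHopf

namespace MatroidHopf

/-! ## The split-merge map is an involution -/

namespace OrderedSetPartition

variable {E : Type u} [LinearOrder E]

theorem part_of_parts_eq_left {π : OrderedSetPartition E} {l l' : List (Finset E)}
    (h : π.parts = l ++ l') {j : ℕ} (hj : j < l.length) : π.part j = l.getD j ∅ := by
  rw [part, h, List.getD_append _ _ _ _ hj]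

theorem part_of_parts_eq_right {π : OrderedSetPartition E} {l l' : List (Finset E)}
    (h : π.parts = l ++ l') (t : ℕ) : π.part (l.length + t) = l'.getD t ∅ := by
  rw [part, h, List.getD_append_right _ _ _ _ (Nat.le_add_right _ _), Nat.add_sub_cancel_left]

theorem partialSize_of_parts_eq_left {π : OrderedSetPartition E} {l l' : List (Finset E)}
    (h : π.parts = l ++ l') {j : ℕ} (hj : j ≤ l.length) :
    π.partialSize j = ((l.take j).map Finset.card).sum := by
  rw [partialSize, h, List.take_append_of_le_length hj]

theorem partialSize_of_parts_eq_right {π : OrderedSetPartition E} {l l' : List (Finset E)}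
    (h : π.parts = l ++ l') (t : ℕ) : π.partialSize (l.length + t) =
      (l.map Finset.card).sum + ((l'.take t).map Finset.card).sum := by
  rw [partialSize, h, List.take_length_add_append, List.map_append, List.sum_append]

theorem partialSize_succ (π : OrderedSetPartition E) (j : ℕ) :
    π.partialSize (j + 1) = π.partialSize j + (π.part j).card := by
  rw [partialSize, partialSize, part, List.take_add_one, List.map_append, List.sum_append,
    List.getD_eq_getElem?_getD]
  cases π.parts[j]? <;> simp

theorem partialSize_mono (π : OrderedSetPartition E) : Monotone π.partialSize :=
  monotone_nat_of_le_succ fun j => by rw [partialSize_succ]; exact Nat.le_add_right _ _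

theorem mem_foldr_union {l : List (Finset E)} {x : E} :
    x ∈ l.foldr (· ∪ ·) ∅ ↔ ∃ B ∈ l, x ∈ B := by
  induction l with
  | nil => simp
  | cons B l ih => simp [ih]

theorem card_foldr_union {l : List (Finset E)} (h : l.Pairwise Disjoint) :
    (l.foldr (· ∪ ·) ∅).card = (l.map Finset.card).sum := by
  induction l with
  | nil => simp
  | cons B l ih =>
    rw [List.pairwise_cons] at h
    rw [List.foldr_cons, Finset.card_union_of_disjoint, ih h.2, List.map_cons, List.sum_cons]
    refine Finset.disjoint_left.2 fun x hx hx' => ?_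
    obtain ⟨C, hC, hxC⟩ := mem_foldr_union.1 hx'
    exact Finset.disjoint_left.1 (h.1 C hC) hx hxC

theorem card_foldr_take (π : OrderedSetPartition E) (j : ℕ) :
    ((π.parts.take j).foldr (· ∪ ·) ∅).card = π.partialSize j :=
  card_foldr_union (π.disjoint.sublist (List.take_sublist _ _))

theorem partialSize_length [Fintype E] (π : OrderedSetPartition E) :
    π.partialSize π.parts.length = Fintype.card E := by
  rw [← card_foldr_take, List.take_length, ← Finset.card_univ]
  congr 1
  exact Finset.eq_univ_iff_forall.2 fun x => mem_foldr_union.2 (π.cover x)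

theorem length_le_card [Fintype E] (π : OrderedSetPartition E) :
    π.parts.length ≤ Fintype.card E := by
  rw [← π.partialSize_length, partialSize, List.take_length, ← List.length_map Finset.card]
  refine List.length_le_sum_of_one_le _ fun n hn => ?_
  obtain ⟨B, hB, rfl⟩ := List.mem_map.1 hn
  exact (π.nonempty B hB).card_pos

theorem pivot_eq {m : ℕ} {π : OrderedSetPartition E} {p : ℕ} (h : m ≤ π.partialSize (p + 1))
    (h' : p = 0 ∨ π.partialSize p < m) : π.pivot m = p := by
  refine le_antisymm (Nat.sInf_le h) (le_csInf ⟨p, h⟩ fun q (hq : m ≤ _) => ?_)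
  by_contra! hlt
  have := π.partialSize_mono (show q + 1 ≤ p from hlt)
  omega

theorem le_pivotSize [Fintype E] {m : ℕ} (hm : m ≤ Fintype.card E) (π : OrderedSetPartition E) :
    m ≤ π.pivotSize m := by
  -- Partial sizes are constant beyond the last part, so this out-of-range witness also serves the
  -- empty partition.
  refine Nat.sInf_mem (s := {i | m ≤ π.partialSize (i + 1)}) ⟨π.parts.length, ?_⟩
  exact hm.trans (π.partialSize_length.symm.le.trans (π.partialSize_mono (Nat.le_succ _)))

theorem pivot_eq_zero_or_lt (m : ℕ) (π : OrderedSetPartition E) :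
    π.pivot m = 0 ∨ π.partialSize (π.pivot m) < m := by
  by_contra! h
  have h' : ¬ m ≤ π.partialSize (π.pivot m - 1 + 1) :=
    Nat.notMem_of_lt_sInf (s := {i | m ≤ π.partialSize (i + 1)}) (Nat.sub_one_lt h.1)
  rw [Nat.sub_add_cancel (Nat.pos_of_ne_zero h.1)] at h'
  exact h' h.2

theorem pivot_lt_length [Fintype E] {m : ℕ} (hm : m ≤ Fintype.card E) {π : OrderedSetPartition E}
    (h : 0 < π.parts.length) : π.pivot m < π.parts.length := by
  have : π.pivot m ≤ π.parts.length - 1 := Nat.sInf_le (by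
    change m ≤ π.partialSize (π.parts.length - 1 + 1)
    rwa [Nat.sub_add_cancel h, partialSize_length])
  omega

/-! ### Parts and partial sizes after a split -/

section Split

variable (π : OrderedSetPartition E) {i : ℕ} (hi : i < π.parts.length) (hc : 1 < (π.part i).card)

theorem length_split : (π.split i hi hc).parts.length = π.parts.length + 1 := by
  simp only [split, List.length_append, List.length_take, List.length_cons, List.length_drop]
  omega

theorem part_split_of_lt {j : ℕ} (hj : j < i) : (π.split i hi hc).part j = π.part j := by
  have hl : (π.parts.take i).length = i := List.length_take_of_le hi.le
  rw [part_of_parts_eq_left rfl (by rwa [hl]),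
    part_of_parts_eq_left (π.parts_eq_of_lt hi) (by rwa [hl])]

theorem part_split_self : ∃ h, (π.split i hi hc).part i = {(π.part i).max' h} := by
  have hl : (π.parts.take i).length = i := List.length_take_of_le hi.le
  refine ⟨Finset.card_pos.1 (Nat.zero_lt_of_lt hc), ?_⟩
  have h := part_of_parts_eq_right (π := π.split i hi hc) rfl 0
  rw [hl] at h
  exact h

theorem part_split_succ : ∃ h, (π.split i hi hc).part (i + 1) =
    (π.part i).erase ((π.part i).max' h) := by
  have hl : (π.parts.take i).length = i := List.length_take_of_le hi.le
  refine ⟨Finset.card_pos.1 (Nat.zero_lt_of_lt hc), ?_⟩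
  have h := part_of_parts_eq_right (π := π.split i hi hc) rfl 1
  rw [hl] at h
  exact h

theorem partialSize_split_of_le {j : ℕ} (hj : j ≤ i) :
    (π.split i hi hc).partialSize j = π.partialSize j := by
  have hl : (π.parts.take i).length = i := List.length_take_of_le hi.le
  rw [partialSize_of_parts_eq_left rfl (by rwa [hl]),
    partialSize_of_parts_eq_left (π.parts_eq_of_lt hi) (by rwa [hl])]

theorem partialSize_split_succ :
    (π.split i hi hc).partialSize (i + 1) = π.partialSize i + 1 := by
  obtain ⟨_, h⟩ := π.part_split_self hi hc
  rw [partialSize_succ, h, Finset.card_singleton, partialSize_split_of_le _ _ _ le_rfl]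

theorem partialSize_split_of_lt {j : ℕ} (hj : i < j) :
    (π.split i hi hc).partialSize (j + 1) = π.partialSize j := by
  have hl : (π.parts.take i).length = i := List.length_take_of_le hi.le
  obtain ⟨t, rfl⟩ := Nat.exists_eq_add_of_lt hj
  have h1 := partialSize_of_parts_eq_right (π := π.split i hi hc) rfl (t + 2)
  have h2 := partialSize_of_parts_eq_right (π.parts_eq_of_lt hi) (t + 1)
  rw [hl] at h1 h2
  rw [show i + t + 1 + 1 = i + (t + 2) by ring, show i + t + 1 = i + (t + 1) by ring, h1, h2]
  simp only [List.take_succ_cons, List.map_cons, List.sum_cons, Finset.card_singleton,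
    Finset.card_erase_of_mem (Finset.max'_mem _ _)]
  omega

theorem sgn_split : (π.split i hi hc).sgn = -π.sgn := by
  rw [sgn, sgn, length_split, pow_succ, mul_neg_one]

end Split

/-! ### Parts and partial sizes after a merge -/

section Merge

variable (π : OrderedSetPartition E) {i : ℕ} (hi : i + 1 < π.parts.length)

theorem length_merge : (π.merge i hi).parts.length + 1 = π.parts.length := by
  simp only [merge, List.length_append, List.length_take, List.length_cons, List.length_drop]
  omega

theorem part_merge_of_lt {j : ℕ} (hj : j < i) : (π.merge i hi).part j = π.part j := by
  have hl : (π.parts.take i).length = i := List.length_take_of_le (by omega)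
  rw [part_of_parts_eq_left rfl (by rwa [hl]),
    part_of_parts_eq_left (π.parts_eq_of_succ_lt hi) (by rwa [hl])]

theorem part_merge_self : (π.merge i hi).part i = π.part i ∪ π.part (i + 1) := by
  have hl : (π.parts.take i).length = i := List.length_take_of_le (by omega)
  have h := part_of_parts_eq_right (π := π.merge i hi) rfl 0
  rw [hl] at h
  exact h

theorem disjoint_part_succ (π : OrderedSetPartition E) {i : ℕ} (hi : i + 1 < π.parts.length) :
    Disjoint (π.part i) (π.part (i + 1)) := by
  have h := π.disjoint
  rw [π.parts_eq_of_succ_lt hi] at h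
  simp only [List.pairwise_append, List.pairwise_cons, List.mem_cons] at h
  exact h.2.1.1 _ (Or.inl rfl)

theorem part_nonempty {j : ℕ} (hj : j < π.parts.length) : (π.part j).Nonempty := by
  rw [part, List.getD_eq_getElem _ _ hj]
  exact π.nonempty _ (List.getElem_mem hj)

theorem partialSize_merge_of_le {j : ℕ} (hj : j ≤ i) :
    (π.merge i hi).partialSize j = π.partialSize j := by
  have hl : (π.parts.take i).length = i := List.length_take_of_le (by omega)
  rw [partialSize_of_parts_eq_left rfl (by rwa [hl]),
    partialSize_of_parts_eq_left (π.parts_eq_of_succ_lt hi) (by rwa [hl])]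

theorem partialSize_merge_of_lt {j : ℕ} (hj : i < j) :
    (π.merge i hi).partialSize j = π.partialSize (j + 1) := by
  have hl : (π.parts.take i).length = i := List.length_take_of_le (by omega)
  obtain ⟨t, rfl⟩ := Nat.exists_eq_add_of_lt hj
  have h1 := partialSize_of_parts_eq_right (π := π.merge i hi) rfl (t + 1)
  have h2 := partialSize_of_parts_eq_right (π.parts_eq_of_succ_lt hi) (t + 2)
  rw [hl] at h1 h2
  rw [show i + t + 1 + 1 = i + (t + 2) by ring, show i + t + 1 = i + (t + 1) by ring, h1, h2]
  simp only [List.take_succ_cons, List.map_cons, List.sum_cons,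
    Finset.card_union_of_disjoint (π.disjoint_part_succ hi)]
  omega

theorem sgn_merge : (π.merge i hi).sgn = -π.sgn := by
  rw [sgn, sgn, ← π.length_merge hi, pow_succ, mul_neg_one, neg_neg]

end Merge

/-! ### Splitting and merging undo each other -/

section Involution

variable {m : ℕ} {π : OrderedSetPartition E} {i : ℕ}

theorem merge_split (hi : i < π.parts.length) (hc : 1 < (π.part i).card)
    (hi' : i + 1 < (π.split i hi hc).parts.length) : (π.split i hi hc).merge i hi' = π := by
  have hl : (π.parts.take i).length = i := List.length_take_of_le hi.le
  obtain ⟨hne, h1⟩ := π.part_split_self hi hc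
  obtain ⟨_, h2⟩ := π.part_split_succ hi hc
  refine OrderedSetPartition.ext ?_
  have h3 : (π.split i hi hc).part i ∪ (π.split i hi hc).part (i + 1) = π.part i := by
    rw [h1, h2, Finset.singleton_union, Finset.insert_erase (Finset.max'_mem _ _)]
  have h4 : (π.split i hi hc).parts.take i = π.parts.take i := by
    rw [split, List.take_left' hl]
  have h5 : (π.split i hi hc).parts.drop (i + 2) = π.parts.drop (i + 1) := by
    have := List.drop_length_add_append (l₁ := π.parts.take i) (i := 2)
      (l₂ := {(π.part i).max' hne} :: (π.part i).erase ((π.part i).max' hne) ::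
        π.parts.drop (i + 1))
    rw [hl] at this
    exact this
  simp only [merge, h3, h4, h5]
  exact (π.parts_eq_of_lt hi).symm

/-- As the single element of part `i` exceeds all of part `i + 1`, it is the maximum of the union,
which is what a split removes. -/
theorem split_merge (hi : i + 1 < π.parts.length) (h1 : (π.part i).card = 1)
    (h : ∀ x ∈ π.part i, ∀ y ∈ π.part (i + 1), y < x) (hi' : i < (π.merge i hi).parts.length)
    (hc : 1 < ((π.merge i hi).part i).card) : (π.merge i hi).split i hi' hc = π := by
  have hl : (π.parts.take i).length = i := List.length_take_of_le (by omega)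
  obtain ⟨e, he⟩ := Finset.card_eq_one.1 h1
  have hp : (π.merge i hi).part i = insert e (π.part (i + 1)) := by
    rw [part_merge_self, he, Finset.singleton_union]
  have hlt : ∀ y ∈ π.part (i + 1), y < e := h e (by simp [he])
  have hmax : ∀ hne, ((π.merge i hi).part i).max' hne = e := by
    intro hne
    refine le_antisymm (Finset.max'_le _ _ _ fun y hy => ?_)
      (Finset.le_max' _ _ (by simp [hp]))
    rw [hp, Finset.mem_insert] at hy
    exact hy.elim le_of_eq fun hy => (hlt y hy).le
  have h2 : ((π.merge i hi).part i).erase e = π.part (i + 1) := by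
    rw [hp, Finset.erase_insert fun he' => (hlt e he').false]
  have h4 : (π.merge i hi).parts.take i = π.parts.take i := by
    rw [merge, List.take_left' hl]
  have h5 : (π.merge i hi).parts.drop (i + 1) = π.parts.drop (i + 2) := by
    have := List.drop_length_add_append (l₁ := π.parts.take i) (i := 1)
      (l₂ := (π.part i ∪ π.part (i + 1)) :: π.parts.drop (i + 2))
    rw [hl] at this
    exact this
  refine OrderedSetPartition.ext ?_
  simp only [split, hmax, h2, h4, h5, ← he]
  exact (π.parts_eq_of_succ_lt hi).symm

theorem CanMerge.not_canSplit (h : π.CanMerge m i) : ¬ π.CanSplit m i :=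
  fun h' => by have := h.2.1; have := h'.2.1; omega

theorem splitMerge_eq_split (h : π.CanSplit m i)
    (hlt : ∀ j < i, ¬ (π.CanSplit m j ∨ π.CanMerge m j)) :
    π.splitMerge m = π.split i h.1 h.2.1 := by
  classical
  have hex : ∃ i, π.CanSplit m i ∨ π.CanMerge m i := ⟨i, Or.inl h⟩
  have hfind : Nat.find hex = i := (Nat.find_eq_iff hex).2 ⟨Or.inl h, hlt⟩
  subst hfind
  unfold splitMerge
  rw [dif_pos hex]
  exact dif_pos h

theorem splitMerge_eq_merge (h : π.CanMerge m i)
    (hlt : ∀ j < i, ¬ (π.CanSplit m j ∨ π.CanMerge m j)) :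
    π.splitMerge m = π.merge i h.1 := by
  classical
  have hex : ∃ i, π.CanSplit m i ∨ π.CanMerge m i := ⟨i, Or.inr h⟩
  have hfind : Nat.find hex = i := (Nat.find_eq_iff hex).2 ⟨Or.inr h, hlt⟩
  subst hfind
  unfold splitMerge
  rw [dif_pos hex]
  exact dif_neg h.not_canSplit

theorem splitMerge_cases (m : ℕ) (π : OrderedSetPartition E) :
    π.splitMerge m = π ∨ ∃ i, (π.CanSplit m i ∨ π.CanMerge m i) ∧
      ∀ j < i, ¬ (π.CanSplit m j ∨ π.CanMerge m j) := by
  classical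
  by_cases hex : ∃ i, π.CanSplit m i ∨ π.CanMerge m i
  · exact Or.inr ⟨Nat.find hex, Nat.find_spec hex, fun j hj => Nat.find_min hex hj⟩
  · exact Or.inl (dif_neg hex)

/-- Ensures that `i` stays the first place to act when `σ` arises from `π` by a move at `i`. Only a
merge at `i - 1` looks at the changed part `i`: `hdom` transfers its order condition, and `hself`
shows that the pivot exception did not block it in `π`. -/
theorem not_canSplit_or_canMerge_of_agree {σ : OrderedSetPartition E} (hi : i < π.parts.length)
    (hpart : ∀ j < i, σ.part j = π.part j)
    (hpivot : ∀ j < i, j = σ.pivot m ↔ j = π.pivot m) (hsize : σ.pivotSize m = π.pivotSize m)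
    (hself : i ≠ π.pivot m ∨ π.pivotSize m = m)
    (hdom : ∀ x, (∀ y ∈ σ.part i, y < x) → ∀ y ∈ π.part i, y < x)
    (hlt : ∀ j < i, ¬ (π.CanSplit m j ∨ π.CanMerge m j)) :
    ∀ j < i, ¬ (σ.CanSplit m j ∨ σ.CanMerge m j) := by
  rintro j hj (⟨-, h1, h2⟩ | ⟨-, h1, h2, h3, h4⟩)
  · refine hlt j hj (Or.inl ⟨by omega, ?_, ?_⟩)
    · rwa [← hpart j hj]
    · rwa [← hsize, Ne, ← hpivot j hj]
  · rw [hpart j hj] at h1 h3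
    refine hlt j hj (Or.inr ⟨by omega, h1, fun h => h2 ((hpivot j hj).2 h), ?_, ?_⟩)
    · intro x hx
      by_cases hji : j + 1 = i
      · rw [hji] at h3 ⊢
        exact hdom x (h3 x hx)
      · rw [← hpart (j + 1) (by omega)]
        exact h3 x hx
    · rintro ⟨h5, h6⟩
      by_cases hji : j + 1 = i
      · rw [hji] at h5
        have := hself.resolve_left (fun h => h h5)
        omega
      · exact h4 ⟨(hpivot (j + 1) (by omega)).2 h5, by rwa [hsize]⟩

variable [Fintype E]

theorem CanSplit.pivot_split (hm : m ≤ Fintype.card E) (h : π.CanSplit m i) :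
    (π.split i h.1 h.2.1).pivot m = if π.pivot m < i then π.pivot m else π.pivot m + 1 := by
  have h1 : m ≤ π.partialSize (π.pivot m + 1) := π.le_pivotSize hm
  have h2 := π.pivot_eq_zero_or_lt m
  split_ifs with hlt
  · refine pivot_eq ?_ ?_
    · rwa [partialSize_split_of_le _ _ _ hlt]
    · rwa [partialSize_split_of_le _ _ _ hlt.le]
  · refine pivot_eq ?_ (Or.inr ?_)
    · rwa [partialSize_split_of_lt _ _ _ (by omega)]
    · obtain heq | hne := eq_or_ne i (π.pivot m)
      -- The pivot part itself is split, which requires pivot size exactly `m`. The remainder is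
      -- nonempty, so the singleton does not yet reach `m` and the second piece is the new pivot.
      · have h3 := h.2.2.resolve_left (fun h => h heq)
        have h4 := π.partialSize_succ i
        have h5 := h.2.1
        rw [pivotSize, ← heq] at h3
        rw [show π.pivot m + 1 = i + 1 by omega, partialSize_split_succ]
        omega
      · rw [partialSize_split_of_lt _ _ _ (by omega)]
        omega

theorem CanSplit.pivotSize_split (hm : m ≤ Fintype.card E) (h : π.CanSplit m i) :
    (π.split i h.1 h.2.1).pivotSize m = π.pivotSize m := by
  rw [pivotSize, h.pivot_split hm]
  split_ifs with hlt
  · rw [partialSize_split_of_le _ _ _ hlt, pivotSize]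
  · rw [partialSize_split_of_lt _ _ _ (by omega), pivotSize]

/-- The size of `I` changes only when the pivot itself is split, and then the pivot size is `m`: the
two cases of `partitionTerm_congr`. -/
theorem CanSplit.partialSize_pivot_split (hm : m ≤ Fintype.card E) (h : π.CanSplit m i) :
    (π.split i h.1 h.2.1).partialSize ((π.split i h.1 h.2.1).pivot m) =
      π.partialSize (π.pivot m) ∨ π.pivotSize m = m := by
  rw [h.pivot_split hm]
  refine h.2.2.imp_left fun hne => ?_
  split_ifs with hlt
  · rw [partialSize_split_of_le _ _ _ hlt.le]
  · rw [partialSize_split_of_lt _ _ _ (by omega)]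

theorem CanMerge.pivotSize_eq (hm : m ≤ Fintype.card E) (h : π.CanMerge m i)
    (h' : i + 1 = π.pivot m) : π.pivotSize m = m := by
  exact (π.le_pivotSize hm).antisymm' (not_lt.1 fun hlt => h.2.2.2.2 ⟨h', hlt⟩)

theorem CanMerge.pivot_merge (hm : m ≤ Fintype.card E) (h : π.CanMerge m i) :
    (π.merge i h.1).pivot m = if π.pivot m < i then π.pivot m else π.pivot m - 1 := by
  have h1 : m ≤ π.partialSize (π.pivot m + 1) := π.le_pivotSize hm
  have h2 := π.pivot_eq_zero_or_lt m
  have hne := h.2.2.1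
  split_ifs with hlt
  · refine pivot_eq ?_ ?_
    · rwa [partialSize_merge_of_le _ _ hlt]
    · rwa [partialSize_merge_of_le _ _ hlt.le]
  · refine pivot_eq ?_ ?_
    · rwa [Nat.sub_add_cancel (by omega), partialSize_merge_of_lt _ _ (by omega)]
    · right
      obtain heq | hne' := eq_or_ne (i + 1) (π.pivot m)
      -- The pivot is absorbed into the merged part, which becomes the pivot at index `i`.
      · have : π.partialSize i ≤ π.partialSize (i + 1) := π.partialSize_mono (Nat.le_succ i)
        rw [show π.pivot m - 1 = i by omega, partialSize_merge_of_le _ _ le_rfl]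
        rw [← heq] at h2
        omega
      · rw [partialSize_merge_of_lt _ _ (by omega), Nat.sub_add_cancel (by omega)]
        omega

theorem CanMerge.pivotSize_merge (hm : m ≤ Fintype.card E) (h : π.CanMerge m i) :
    (π.merge i h.1).pivotSize m = π.pivotSize m := by
  have hne := h.2.2.1
  rw [pivotSize, h.pivot_merge hm]
  split_ifs with hlt
  · rw [partialSize_merge_of_le _ _ hlt, pivotSize]
  · rw [Nat.sub_add_cancel (by omega), partialSize_merge_of_lt _ _ (by omega), pivotSize]

theorem CanMerge.partialSize_pivot_merge (hm : m ≤ Fintype.card E) (h : π.CanMerge m i) :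
    (π.merge i h.1).partialSize ((π.merge i h.1).pivot m) =
      π.partialSize (π.pivot m) ∨ π.pivotSize m = m := by
  have hne := h.2.2.1
  rw [h.pivot_merge hm]
  obtain heq | hne' := eq_or_ne (i + 1) (π.pivot m)
  · exact Or.inr (h.pivotSize_eq hm heq)
  · left
    split_ifs with hlt
    · rw [partialSize_merge_of_le _ _ hlt.le]
    · rw [partialSize_merge_of_lt _ _ (by omega), Nat.sub_add_cancel (by omega)]

theorem splitMerge_split (hm : m ≤ Fintype.card E) (h : π.CanSplit m i)
    (hlt : ∀ j < i, ¬ (π.CanSplit m j ∨ π.CanMerge m j)) :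
    (π.split i h.1 h.2.1).splitMerge m = π := by
  have hp := h.pivot_split hm
  have hs := h.pivotSize_split hm
  obtain ⟨hne, h1⟩ := π.part_split_self h.1 h.2.1
  obtain ⟨_, h2⟩ := π.part_split_succ h.1 h.2.1
  have hmerge : (π.split i h.1 h.2.1).CanMerge m i := by
    refine ⟨?_, ?_, ?_, ?_, ?_⟩
    · rw [length_split]
      exact Nat.succ_lt_succ h.1
    · rw [h1, Finset.card_singleton]
    · rw [hp]
      split_ifs <;> omega
    · rw [h1, h2]
      intro x hx y hy
      rw [Finset.mem_singleton.1 hx]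
      exact Finset.lt_max'_of_mem_erase_max' _ _ hy
    · rw [hp, hs]
      -- The new pivot is at `i + 1` only if `i` was the pivot, and then the split required pivot
      -- size `m`.
      rintro ⟨h3, h4⟩
      have := h.2.2
      split_ifs at h3 <;> omega
  refine (splitMerge_eq_merge hmerge ?_).trans (merge_split h.1 h.2.1 hmerge.1)
  refine not_canSplit_or_canMerge_of_agree h.1 (fun j hj => part_split_of_lt _ _ _ hj)
    (fun j hj => ?_) hs h.2.2 (fun x hx y hy => ?_) hlt
  · rw [hp]
    split_ifs <;> omega
  · rw [h1] at hx
    -- Exceeding the new singleton means exceeding the maximum of the old part.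
    exact (Finset.le_max' _ y hy).trans_lt (hx _ (Finset.mem_singleton_self _))

theorem splitMerge_merge (hm : m ≤ Fintype.card E) (h : π.CanMerge m i)
    (hlt : ∀ j < i, ¬ (π.CanSplit m j ∨ π.CanMerge m j)) :
    (π.merge i h.1).splitMerge m = π := by
  have hp := h.pivot_merge hm
  have hs := h.pivotSize_merge hm
  have hpart := π.part_merge_self h.1
  have hsplit : (π.merge i h.1).CanSplit m i := by
    refine ⟨?_, ?_, ?_⟩
    · have := π.length_merge h.1
      have := h.1
      omega
    · rw [hpart, Finset.card_union_of_disjoint (π.disjoint_part_succ h.1), h.2.1]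
      have := (π.part_nonempty h.1).card_pos
      omega
    · rw [hp, hs]
      have := h.2.2.1
      obtain heq | hne := eq_or_ne (i + 1) (π.pivot m)
      · exact Or.inr (h.pivotSize_eq hm heq)
      · left
        split_ifs <;> omega
  refine (splitMerge_eq_split hsplit ?_).trans
    (split_merge h.1 h.2.1 h.2.2.2.1 hsplit.1 hsplit.2.1)
  refine not_canSplit_or_canMerge_of_agree (Nat.lt_of_succ_lt h.1)
    (fun j hj => part_merge_of_lt _ _ hj) (fun j hj => ?_) hs (Or.inl h.2.2.1)
    (fun x hx y hy => hx y ?_) hlt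
  · have := h.2.2.1
    rw [hp]
    split_ifs <;> omega
  · rw [hpart]
    exact Finset.mem_union_left _ hy

theorem splitMerge_involutive (hm : m ≤ Fintype.card E) :
    Function.Involutive (splitMerge (E := E) m) := by
  intro π
  obtain h | ⟨i, h | h, hlt⟩ := π.splitMerge_cases m
  · rw [h, h]
  · rw [splitMerge_eq_split h hlt, splitMerge_split hm h hlt]
  · rw [splitMerge_eq_merge h hlt, splitMerge_merge hm h hlt]

end Involution

end OrderedSetPartition

/-! ### Takeuchi's sum over ordered set partitions and its cancellation -/

section Final

variable (k : Type*) [Field k] (F : MatroidFamily.{u}) {E : Type u} [Fintype E] [LinearOrder E]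

open OrderedSetPartition

/-- The direct sum of uniform matroids contributed by an ordered set partition. -/
noncomputable def partitionTerm (m : ℕ) (π : OrderedSetPartition E) : MatroidAlgebra k F :=
  uniformElement k F (π.setI m).card (π.setI m) *
    uniformElement k F (m - (π.setI m).card) (π.setL m) *
    uniformElement k F 0 (Finset.univ \ (π.setI m ∪ π.setL m))

theorem partitionTerm_eq (m : ℕ) (π : OrderedSetPartition E) :
    partitionTerm k F m π =
      uniformBasis k F (π.partialSize (π.pivot m)) (π.partialSize (π.pivot m)) *
        uniformBasis k F (m - π.partialSize (π.pivot m))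
          (π.pivotSize m - π.partialSize (π.pivot m)) *
        uniformBasis k F 0 (Fintype.card E - π.pivotSize m) := by
  have hI : (π.setI m).card = π.partialSize (π.pivot m) := π.card_foldr_take _
  have hL : (π.setL m).card = π.pivotSize m - π.partialSize (π.pivot m) := by
    rw [pivotSize, partialSize_succ, Nat.add_sub_cancel_left, setL]
  have hIL : π.setI m ∪ π.setL m =
      (π.parts.take (π.pivot m + 1)).foldr (· ∪ ·) ∅ := by
    ext x
    rw [Finset.mem_union, setI, setL, mem_foldr_union, mem_foldr_union, List.take_add_one, part,
      List.getD_eq_getElem?_getD]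
    cases π.parts[π.pivot m]? <;> simp [or_and_right, exists_or]
  have hc : (Finset.univ \ (π.setI m ∪ π.setL m)).card = Fintype.card E - π.pivotSize m := by
    rw [Finset.card_sdiff_of_subset (Finset.subset_univ _), Finset.card_univ, hIL,
      card_foldr_take, pivotSize]
  rw [partitionTerm, uniformElement_eq, uniformElement_eq, uniformElement_eq, hc, hL, hI]

/-- The term depends only on `|I|` and the pivot size. When the pivot size is `m`, the factors for
`I` and `L` are both free and multiply to `U^m_m`, so `|I|` no longer matters. -/
theorem partitionTerm_congr {m : ℕ} {π σ : OrderedSetPartition E}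
    (h : σ.pivotSize m = π.pivotSize m)
    (h' : σ.partialSize (σ.pivot m) = π.partialSize (π.pivot m) ∨ π.pivotSize m = m) :
    partitionTerm k F m σ = partitionTerm k F m π := by
  rw [partitionTerm_eq, partitionTerm_eq, h]
  obtain h' | h' := h'
  · rw [h']
  · have h1 : σ.partialSize (σ.pivot m) ≤ m :=
      (σ.partialSize_mono (Nat.le_succ _)).trans (h.trans h').le
    have h2 : π.partialSize (π.pivot m) ≤ m :=
      (π.partialSize_mono (Nat.le_succ _)).trans h'.le
    rw [h', uniformBasis_free_mul, uniformBasis_free_mul, Nat.add_sub_cancel' h1,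
      Nat.add_sub_cancel' h2]

theorem minorProduct_parts {m : ℕ} (hm : m ≤ Fintype.card E) (π : OrderedSetPartition E) :
    minorProduct k F m (π.parts.map Finset.card) = partitionTerm k F m π := by
  have hsum : (π.parts.map Finset.card).sum = Fintype.card E := by
    rw [← π.partialSize_length, partialSize, List.take_length]
  -- With no parts the pivot is not a valid index, so `minorProduct_eq` does not apply; then `E` is
  -- empty and every factor is `1`.
  obtain hl | hl := Nat.eq_zero_or_pos π.parts.length
  · have hE : Fintype.card E = 0 := by
      rw [← hsum, List.length_eq_zero_iff.1 hl]
      rfl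
    have h0 : ∀ j, π.partialSize j = 0 := by
      intro j
      rw [partialSize, List.length_eq_zero_iff.1 hl]
      simp
    rw [partitionTerm_eq, List.length_eq_zero_iff.1 hl, pivotSize, h0, h0, hE]
    simp [minorProduct, uniformBasis_card_zero]
  · have h1 := π.le_pivotSize hm
    have h2 := π.pivot_eq_zero_or_lt m
    rw [pivotSize] at h1
    simp only [partialSize, List.map_take] at h1 h2
    rw [minorProduct_eq k F m _ (π.pivot m) (by simpa using pivot_lt_length hm hl) h2 h1,
      partitionTerm_eq, hsum]
    simp only [pivotSize, partialSize, List.map_take]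

theorem antipode_uniformElement {m : ℕ} (hm : m ≤ Fintype.card E) :
    antipode k F (uniformElement k F m (Finset.univ : Finset E)) =
      ∑ π : OrderedSetPartition E, π.sgn • partitionTerm k F m π := by
  rw [uniformElement, antipode_basisElement]
  change convolutionInverse _ (matroidClass (uniformOn m Finset.univ)) = _
  rw [convolutionInverse, size_matroidClass, groundFinset_uniformOn, Finset.card_univ]
  simp_rw [reducedPower_uniform, Finset.mul_sum]
  rw [Finset.sum_sigma']
  refine Finset.sum_bij' (fun p hp => ⟨p.2, ?_, ?_, ?_⟩) (fun π _ => ⟨π.parts.length, π.parts⟩)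
    ?_ ?_ ?_ ?_ ?_
  · exact (mem_partitionLists.1 (Finset.mem_sigma.1 hp).2).2.1
  · exact (mem_partitionLists.1 (Finset.mem_sigma.1 hp).2).2.2.1
  · exact fun x => ((mem_partitionLists.1 (Finset.mem_sigma.1 hp).2).2.2.2 x).1 (Finset.mem_univ x)
  · exact fun _ _ => Finset.mem_univ _
  · intro π _
    refine Finset.mem_sigma.2 ⟨Finset.mem_range.2 (Nat.lt_succ_of_le π.length_le_card), ?_⟩
    exact mem_partitionLists.2 ⟨rfl, π.nonempty, π.disjoint,
      fun x => iff_of_true (Finset.mem_univ x) (π.cover x)⟩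
  · rintro ⟨j, l⟩ hp
    have hl : l.length = j := (mem_partitionLists.1 (Finset.mem_sigma.1 hp).2).1
    subst hl
    rfl
  · exact fun _ _ => rfl
  · rintro ⟨j, l⟩ hp
    have hl : l.length = j := (mem_partitionLists.1 (Finset.mem_sigma.1 hp).2).1
    subst hl
    rw [← minorProduct_parts k F hm, sgn, zsmul_eq_mul]
    push_cast
    rfl

theorem splitMerge_term {m : ℕ} (hm : m ≤ Fintype.card E) (π : OrderedSetPartition E)
    (h : π.splitMerge m ≠ π) :
    (π.splitMerge m).sgn • partitionTerm k F m (π.splitMerge m) =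
      -(π.sgn • partitionTerm k F m π) := by
  obtain h' | ⟨i, h' | h', hlt⟩ := π.splitMerge_cases m
  · exact absurd h' h
  · rw [splitMerge_eq_split h' hlt, sgn_split, neg_smul, partitionTerm_congr k F
      (h'.pivotSize_split hm) (h'.partialSize_pivot_split hm)]
  · rw [splitMerge_eq_merge h' hlt, sgn_merge, neg_smul, partitionTerm_congr k F
      (h'.pivotSize_merge hm) (h'.partialSize_pivot_merge hm)]

end Final

end MatroidHopf

theorem mainTheorem2 {k : Type*} [Field k] (F : MatroidFamily.{u})
    {E : Type u} [Fintype E] [LinearOrder E] (m : ℕ) (hm : m ≤ Fintype.card E) :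
    ∃ S : MatroidAlgebra k F →ₗ[k] MatroidAlgebra k F,
      IsAntipode k F S ∧ (∀ S', IsAntipode k F S' → S' = S) ∧
      S (uniformElement k F m (Finset.univ : Finset E)) =
        ∑ π : OrderedSetPartition E with π.splitMerge m = π,
          π.sgn • (uniformElement k F (π.setI m).card (π.setI m) *
            uniformElement k F (m - (π.setI m).card) (π.setL m) *
            uniformElement k F 0 (Finset.univ \ (π.setI m ∪ π.setL m))) := by
  refine ⟨antipode k F, isAntipode_antipode k F, fun S' hS' => hS'.eq_antipode, ?_⟩
  rw [antipode_uniformElement k F hm,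
    ← Finset.sum_filter_add_sum_filter_not _ (fun π : OrderedSetPartition E => π.splitMerge m = π)]
  -- What remains is that the partitions moved by `splitMerge` contribute zero; `rfl` unfolds
  -- `partitionTerm`.
  refine (add_eq_left.2 ?_).trans rfl
  have hinv := OrderedSetPartition.splitMerge_involutive (E := E) hm
  refine Finset.sum_involution (fun π _ => π.splitMerge m) ?_ ?_ ?_ ?_
  · intro π hπ
    rw [splitMerge_term k F hm π (Finset.mem_filter.1 hπ).2, add_neg_cancel]
  · exact fun π hπ _ => (Finset.mem_filter.1 hπ).2
  · intro π hπ
    refine Finset.mem_filter.2 ⟨Finset.mem_univ _, fun h => (Finset.mem_filter.1 hπ).2 ?_⟩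
    rw [hinv] at h
    exact h.symm
  · exact fun π _ => hinv π
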